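/- Let $(M^n,g)$ be a (nonempty, Hausdorff, second countable) smooth $n$-dimensional Riemannian manifold without boundary, let $u\in C^\infty(M)$, $V=e^u$, $\lambda,\mu\in\mathbb R$ and $\tau=(n+1)\lambda+\mu$; write $dv_g$, $\nabla$, $\Delta$ for the Riemannian volume, gradient and Laplacian. For the affine connection $D=D^{\lambda,\mu}$, $D_XY=\nabla_XY+\lambda\,du(X)Y+\lambda\,du(Y)X+\mu\,g(X,Y)\nabla u$, the affine gradient and the affine Laplacian of a function $f$ are $$\nabla^Df=V^{\mu-\lambda}\nabla f,\qquad \Delta^Df=V^{\mu-\lambda}\big[\Delta f+(2\mu+n\lambda)\langle\nabla u,\nabla f\rangle\big].$$ Let $\rho:M\to[0,\infty)$ be continuous and put $\Omega=M\setminus\rho^{-1}\{0\}$. Let $C>1$ and $m\in\mathbb R$ with $C-2m-1\ge 0$, let $c,d>0$, and let $\alpha,\beta\in\mathbb R$ with $\alpha\beta>0$. Assume that in $\Omega$, in the sense of distributions, $$|\nabla^D\rho|=1\qquad\text{and}\qquad \Delta^D\rho\ \ge\ \frac{C}{\rho}\,V^{\lambda-\mu}.$$ That is, $\rho$ has on $\Omega$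 a locally integrable weak gradient $\nabla\rho$ with $|V^{\mu-\lambda}\nabla\rho|=1$ almost everywhere in $\Omega$, and for every $0\le\psi\in C_0^\infty(\Omega)$, $$-\int_M\big\langle\nabla\rho,\nabla(V^{\mu-\lambda}\psi)\big\rangle\,dv_g+\int_M V^{\mu-\lambda}(2\mu+n\lambda)\langle\nabla u,\nabla\rho\rangle\,\psi\,dv_g\ \ge\ \int_M\frac{C}{\rho}\,V^{\lambda-\mu}\psi\,dv_g .$$ Then for every $\phi\in C_0^\infty(\Omega)$ both integrands below are integrable, and $$\int_M\frac{(c+d\rho^\alpha)^\beta}{\rho^{2m}}\,|\nabla^D\phi|^2\,V^{\tau+\lambda-\mu}\,dv_g\ \ge\ \Big(\frac{C-2m-1}{2}\Big)^2\int_M\frac{(c+d\rho^\alpha)^\beta}{\rho^{2m+2}}\,\phi^2\,V^{\tau+\lambda-\mu}\,dv_g .$$ -/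

import Mathlib

open Set MeasureTheory Manifold Bundle
open scoped ContDiff Topology

noncomputable section

namespace AffineHardy

section Defs

variable {n : ℕ} {M : Type*} [TopologicalSpace M] [ChartedSpace (EuclideanSpace ℝ (Fin n)) M]

/-- The coordinate vector `dψ_y(v)` on `M`, where `ψ` is the inverse of the preferred chart at `p`
and `v` is a vector of `ℝⁿ`. For the standard basis vectors `v` these are the coordinate fields
`∂/∂xⁱ` of the chart, at the point `ψ y`. -/
def coordVec (p : M) (y v : EuclideanSpace ℝ (Fin n)) :
    TangentSpace (𝓡 n) ((chartAt (EuclideanSpace ℝ (Fin n)) p).symm y) :=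
  mfderiv (𝓡 n) (𝓡 n) (chartAt (EuclideanSpace ℝ (Fin n)) p).symm y v

/-- A test function: smooth on `M`, with compact support contained in `U`. -/
def IsTestFunction (n : ℕ) [ChartedSpace (EuclideanSpace ℝ (Fin n)) M] (U : Set M)
    (φ : M → ℝ) : Prop :=
  ContMDiff (𝓡 n) 𝓘(ℝ, ℝ) ∞ φ ∧ HasCompactSupport φ ∧ tsupport φ ⊆ U

/-- Countably many preferred chart domains cover a second countable manifold. -/
theorem exists_chart_cover (n : ℕ) (M : Type*) [TopologicalSpace M]
    [ChartedSpace (EuclideanSpace ℝ (Fin n)) M] [SecondCountableTopology M] [Nonempty M] :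
    ∃ p : ℕ → M, ⋃ i, (chartAt (EuclideanSpace ℝ (Fin n)) (p i)).source = univ := by
  obtain ⟨s, hs, hcov⟩ := TopologicalSpace.countable_cover_nhds
    (fun x : M => chart_source_mem_nhds (EuclideanSpace ℝ (Fin n)) x)
  have hne : s.Nonempty := by
    obtain ⟨x⟩ := (inferInstance : Nonempty M)
    have hx : x ∈ ⋃ y ∈ s, (chartAt (EuclideanSpace ℝ (Fin n)) y).source := hcov ▸ mem_univ x
    simp only [mem_iUnion] at hx
    obtain ⟨y, hy, -⟩ := hx
    exact ⟨y, hy⟩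
  obtain ⟨p, rfl⟩ := hs.exists_eq_range hne
  exact ⟨p, by simpa using hcov⟩

/-- Centres of a sequence of preferred charts whose domains cover `M`. -/
def chartCentre (n : ℕ) (M : Type*) [TopologicalSpace M]
    [ChartedSpace (EuclideanSpace ℝ (Fin n)) M] [SecondCountableTopology M] [Nonempty M] :
    ℕ → M :=
  (exists_chart_cover n M).choose

variable [RiemannianBundle (fun x : M => TangentSpace (𝓡 n) x)]

/-- The Gram matrix `gᵢⱼ = g(∂/∂xⁱ, ∂/∂xʲ)` of the metric in the preferred chart at `p`, at the
point of `M` whose coordinate is `y`. -/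
def gram (p : M) (y : EuclideanSpace ℝ (Fin n)) : Matrix (Fin n) (Fin n) ℝ :=
  Matrix.of fun i j => inner ℝ (coordVec p y (EuclideanSpace.single i 1))
    (coordVec p y (EuclideanSpace.single j 1))

/-- The measure `√(det gᵢⱼ) dx¹ ⋯ dxⁿ` of the preferred chart at `p`, as a measure on `M` carried
by the domain of the chart. -/
def chartVolume [MeasurableSpace M] (p : M) : Measure M :=
  ((volume.restrict (chartAt (EuclideanSpace ℝ (Fin n)) p).target).withDensity
    (fun y => ENNReal.ofReal (Real.sqrt (gram p y).det))).map
      (chartAt (EuclideanSpace ℝ (Fin n)) p).symm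

/-- The Riemannian volume measure `dv_g`: the charts of a countable cover are
made disjoint, and on each resulting piece the measure is `√(det gᵢⱼ) dx¹ ⋯ dxⁿ`. (By the change of
variables formula, it has this form in every chart, whatever the cover.) -/
def riemVolume (n : ℕ) (M : Type*) [TopologicalSpace M]
    [ChartedSpace (EuclideanSpace ℝ (Fin n)) M] [SecondCountableTopology M] [Nonempty M]
    [RiemannianBundle (fun x : M => TangentSpace (𝓡 n) x)] [MeasurableSpace M] : Measure M :=
  Measure.sum fun i : ℕ => (chartVolume (n := n) (chartCentre n M i)).restrict
    (disjointed (fun j => (chartAt (EuclideanSpace ℝ (Fin n)) (chartCentre n M j)).source) i)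

/-- The Riemannian gradient `∇f` of a (differentiable) function: `⟨∇f, v⟩ = df(v)`. -/
def grad (f : M → ℝ) (x : M) : TangentSpace (𝓡 n) x :=
  haveI : FiniteDimensional ℝ (TangentSpace (𝓡 n) x) :=
    inferInstanceAs (FiniteDimensional ℝ (EuclideanSpace ℝ (Fin n)))
  haveI : CompleteSpace (TangentSpace (𝓡 n) x) := FiniteDimensional.complete ℝ _
  (InnerProductSpace.toDual ℝ (TangentSpace (𝓡 n) x)).symm
    (mfderiv (𝓡 n) 𝓘(ℝ, ℝ) f x : TangentSpace (𝓡 n) x →L[ℝ] ℝ)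

/-- The vector field `Z` is the gradient of `f` on the open set `U` in the sense of distributions:
in each chart, `f` and the components `⟨Z, ∂ᵥ⟩` are locally integrable on the part of the
chart lying in `U`, and `⟨Z, ∂ᵥ⟩` is the weak partial derivative of `f` in the direction `v`. -/
def IsWeakGradientOn (U : Set M) (f : M → ℝ) (Z : (x : M) → TangentSpace (𝓡 n) x) : Prop :=
  ∀ (p : M) (v : EuclideanSpace ℝ (Fin n)),
    let e := chartAt (EuclideanSpace ℝ (Fin n)) p
    let W : Set (EuclideanSpace ℝ (Fin n)) := e.target ∩ e.symm ⁻¹' U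
    LocallyIntegrableOn (fun y => f (e.symm y)) W volume ∧
    LocallyIntegrableOn (fun y => inner ℝ (Z (e.symm y)) (coordVec p y v)) W volume ∧
    ∀ η : EuclideanSpace ℝ (Fin n) → ℝ, ContDiff ℝ ∞ η → HasCompactSupport η → tsupport η ⊆ W →
      ∫ y, f (e.symm y) * fderiv ℝ η y v
        = - ∫ y, inner ℝ (Z (e.symm y)) (coordVec p y v) * η y

/-- The affine gradient `V^(μ - λ) ∇f`, `V = e^u`, of a function whose gradient is `Z`. -/
def affineGrad (lam mu : ℝ) (u : M → ℝ) (Z : (x : M) → TangentSpace (𝓡 n) x) (x : M) :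
    TangentSpace (𝓡 n) x :=
  (Real.exp (u x) ^ (mu - lam)) • Z x

variable [SecondCountableTopology M] [Nonempty M] [MeasurableSpace M]

/-- The distributional Laplacian `Δf` of a function `f` with weak gradient `Z`, as a distribution:
`⟨Δf, ψ⟩ = - ∫ ⟨Z, ∇ψ⟩ dv_g`. -/
def laplacian (Z : (x : M) → TangentSpace (𝓡 n) x) (ψ : M → ℝ) : ℝ :=
  - ∫ x, inner ℝ (Z x) (grad ψ x) ∂(riemVolume n M)

/-- The affine Laplacian `Δ^D f = V^(μ - λ) [Δf + (2μ + nλ) ⟨∇u, ∇f⟩]`, `V = e^u`, of a function `f`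
with weak gradient `Z`, as a distribution (`ψ` is the test function). -/
def affineLaplacian (lam mu : ℝ) (u : M → ℝ) (Z : (x : M) → TangentSpace (𝓡 n) x)
    (ψ : M → ℝ) : ℝ :=
  laplacian Z (fun x => Real.exp (u x) ^ (mu - lam) * ψ x) +
    ∫ x, Real.exp (u x) ^ (mu - lam) * ((2 * mu + n * lam) * inner ℝ (grad u x) (Z x)) * ψ x
      ∂(riemVolume n M)

/-- `Δ^D f ≥ h` on the open set `U` in the sense of distributions, `Z` being the weak gradient
of `f`. -/
def AffineLaplacianGE (lam mu : ℝ) (u : M → ℝ) (U : Set M)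
    (Z : (x : M) → TangentSpace (𝓡 n) x) (h : M → ℝ) : Prop :=
  ∀ ψ : M → ℝ, IsTestFunction n U ψ → (∀ x, 0 ≤ ψ x) →
    ∫ x, h x * ψ x ∂(riemVolume n M) ≤ affineLaplacian lam mu u Z ψ

end Defs

end AffineHardy

end

set_option linter.unusedSectionVars false

/-! Put `h r = (c + d r^α)^β r^(-(2m+1))`, `k = (C - 2m - 1)/2`, `a = V^(μ-λ)`, `b = 1/a` and `W =
V^(τ+λ-μ)`. The proof tests the Laplacian inequality with `ψ = h(ρ) V^τ φ²`.

Since `(μ-λ) + τ = 2μ + nλ`, the product `a V^τ` is `V^(2μ+nλ)`. Differentiating this factor yields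
a multiple of `⟨∇u, ∇ρ⟩` that cancels the drift term exactly. Because `|∇ρ| = b`, what remains is `∫
W [C (h/ρ) φ² + 2 h a² φ ⟨∇ρ, ∇φ⟩ + h'(ρ) φ²] ≤ 0`. The sign of `αβ` gives `h' ≥ -(2m+1) h/r`
(`le_deriv_hardyWeight`), and Cauchy-Schwarz bounds the middle term below by `-2 h |φ| |∇^D φ|`.
Multiplying by `k ≥ 0` and completing the square (`sq_mul_sub_le`) gives the result, as `h ρ` and
`h/ρ` are the two radial weights of the inequality.

The analytic difficulty is that `h(ρ)` is not smooth, so `ψ` is not an admissible test function. In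
a chart, `ρ` is mollified. The approximations converge uniformly on compact sets; their gradients
are bounded there, because `|∇ρ| = b` is locally bounded, and converge almost everywhere by Lebesgue
differentiation. Dominated convergence then justifies the test function when the cutoff is supported
in one chart (`integral_testIntegrand_nonpos_of_chart`). The tested integrand is additive in the
cutoff, so a smooth partition of unity removes that restriction (`integral_testIntegrand_nonpos`).

No integration by parts on the manifold is needed. Of the Riemannian volume, the limiting argument
uses only local finiteness and the fact that it has the same null sets as Lebesgue measure in every
chart. -/

noncomputable section

namespace AffineHardy

local notation "𝔼" n:max => EuclideanSpace ℝ (Fin n)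

/-! ### Coordinate fields and the Gram matrix in a chart. -/

section ChartGeometry

variable {n : ℕ} {M : Type*} [TopologicalSpace M] [ChartedSpace (𝔼 n) M]

/-- The linear map `v ↦ coordVec p y v`. -/
def coordMap (p : M) (y : 𝔼 n) : (𝔼 n) →L[ℝ] TangentSpace (𝓡 n) ((chartAt (𝔼 n) p).symm y) :=
  mfderiv (𝓡 n) (𝓡 n) (chartAt (𝔼 n) p).symm y

lemma coordVec_eq (p : M) (y v : 𝔼 n) : coordVec p y v = coordMap p y v := rfl

section
variable [RiemannianBundle (fun x : M => TangentSpace (𝓡 n) x)]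

lemma inner_grad (ψ : M → ℝ) (x : M) (v : TangentSpace (𝓡 n) x) :
    inner ℝ v (grad ψ x) = mfderiv (𝓡 n) 𝓘(ℝ, ℝ) ψ x v := by
  have : FiniteDimensional ℝ (TangentSpace (𝓡 n) x) :=
    inferInstanceAs (FiniteDimensional ℝ (𝔼 n))
  have : CompleteSpace (TangentSpace (𝓡 n) x) := FiniteDimensional.complete ℝ _
  rw [real_inner_comm]
  exact InnerProductSpace.toDual_symm_apply

lemma gram_eq (p : M) (y : 𝔼 n) : gram p y =
    Matrix.gram ℝ (fun i : Fin n => coordVec p y (EuclideanSpace.single i 1)) := rfl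

end

variable [IsManifold (𝓡 n) ∞ M]

lemma contMDiffOn_chart' (p : M) :
    ContMDiffOn (𝓡 n) (𝓡 n) ∞ (chartAt (𝔼 n) p) (chartAt (𝔼 n) p).source :=
  contMDiffOn_chart

lemma contMDiffOn_chart_symm' (p : M) :
    ContMDiffOn (𝓡 n) (𝓡 n) ∞ (chartAt (𝔼 n) p).symm (chartAt (𝔼 n) p).target :=
  contMDiffOn_chart_symm

lemma mdifferentiableAt_chart_symm {p : M} {y : 𝔼 n} (hy : y ∈ (chartAt (𝔼 n) p).target) :
    MDifferentiableAt (𝓡 n) (𝓡 n) (chartAt (𝔼 n) p).symm y :=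
  ((contMDiffOn_chart_symm' p).contMDiffAt
    ((chartAt (𝔼 n) p).open_target.mem_nhds hy)).mdifferentiableAt (by simp)

lemma mdifferentiableAt_chart {p x : M} (hx : x ∈ (chartAt (𝔼 n) p).source) :
    MDifferentiableAt (𝓡 n) (𝓡 n) (chartAt (𝔼 n) p) x :=
  ((contMDiffOn_chart' p).contMDiffAt
    ((chartAt (𝔼 n) p).open_source.mem_nhds hx)).mdifferentiableAt (by simp)

lemma mfderiv_coordVec {F : Type*} [NormedAddCommGroup F] [NormedSpace ℝ F] {p : M} {y : 𝔼 n}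
    (hy : y ∈ (chartAt (𝔼 n) p).target) {ψ : M → F}
    (hψ : MDifferentiableAt (𝓡 n) 𝓘(ℝ, F) ψ ((chartAt (𝔼 n) p).symm y)) (v : 𝔼 n) :
    mfderiv (𝓡 n) 𝓘(ℝ, F) ψ ((chartAt (𝔼 n) p).symm y) (coordVec p y v)
      = fderiv ℝ (fun z => ψ ((chartAt (𝔼 n) p).symm z)) y v := by
  have h := mfderiv_comp y hψ (mdifferentiableAt_chart_symm hy)
  rw [← mfderiv_eq_fderiv]
  exact (DFunLike.congr_fun h v).symm

/-- The derivative of the chart is a left inverse, by the chain rule. -/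
lemma coordMap_injective {p : M} {y : 𝔼 n} (hy : y ∈ (chartAt (𝔼 n) p).target) :
    Function.Injective (coordMap p y) := by
  have h1 : ∀ v, mfderiv (𝓡 n) (𝓡 n) (chartAt (𝔼 n) p) ((chartAt (𝔼 n) p).symm y) (coordVec p y v)
      = v := by
    intro v
    refine (mfderiv_coordVec hy (mdifferentiableAt_chart ((chartAt (𝔼 n) p).map_target hy)) v).trans ?_
    have : (fun z => chartAt (𝔼 n) p ((chartAt (𝔼 n) p).symm z)) =ᶠ[𝓝 y] id := by
      filter_upwards [(chartAt (𝔼 n) p).open_target.mem_nhds hy] with z hz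
      exact (chartAt (𝔼 n) p).right_inv hz
    rw [this.fderiv_eq, fderiv_id]
    rfl
  intro v w hvw
  rw [← h1 v, ← h1 w]
  exact congrArg _ hvw

lemma linearIndependent_coordVec {p : M} {y : 𝔼 n} (hy : y ∈ (chartAt (𝔼 n) p).target) :
    LinearIndependent ℝ (fun i : Fin n => coordVec p y (EuclideanSpace.single i 1)) := by
  have h := (EuclideanSpace.basisFun (Fin n) ℝ).toBasis.linearIndependent
  have := h.map' (coordMap p y).toLinearMap
    (LinearMap.ker_eq_bot.2 (coordMap_injective hy))
  have e : (fun i : Fin n => coordVec p y (EuclideanSpace.single i 1)) =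
      coordMap p y ∘ (EuclideanSpace.basisFun (Fin n) ℝ).toBasis := by
    funext i
    simp [coordVec_eq]
  rw [e]
  exact this

lemma span_coordVec {p : M} {y : 𝔼 n} (hy : y ∈ (chartAt (𝔼 n) p).target) :
    Submodule.span ℝ (range fun i : Fin n => coordVec p y (EuclideanSpace.single i 1)) = ⊤ := by
  have : FiniteDimensional ℝ (TangentSpace (𝓡 n) ((chartAt (𝔼 n) p).symm y)) :=
    inferInstanceAs (FiniteDimensional ℝ (𝔼 n))
  apply (linearIndependent_coordVec hy).span_eq_top_of_card_eq_finrank'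
  have : Module.finrank ℝ (TangentSpace (𝓡 n) ((chartAt (𝔼 n) p).symm y)) = Module.finrank ℝ (𝔼 n) := rfl
  rw [this]
  simp


variable [RiemannianBundle (fun x : M => TangentSpace (𝓡 n) x)]

lemma gram_posDef {p : M} {y : 𝔼 n} (hy : y ∈ (chartAt (𝔼 n) p).target) : (gram p y).PosDef := by
  rw [gram_eq]
  exact Matrix.posDef_gram_of_linearIndependent (linearIndependent_coordVec hy)

lemma gram_det_pos {p : M} {y : 𝔼 n} (hy : y ∈ (chartAt (𝔼 n) p).target) : 0 < (gram p y).det :=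
  (gram_posDef hy).det_pos

/-- The metric in coordinates: `⟨v, w⟩ = ∑ ⟨v, ∂ᵢ⟩ gⁱʲ ⟨∂ⱼ, w⟩`. -/
lemma inner_eq_sum_gram_inv {p : M} {y : 𝔼 n} (hy : y ∈ (chartAt (𝔼 n) p).target)
    (v w : TangentSpace (𝓡 n) ((chartAt (𝔼 n) p).symm y)) :
    inner ℝ v w = ∑ i, ∑ j, inner ℝ v (coordVec p y (EuclideanSpace.single i 1)) *
      ((gram p y)⁻¹ i j * inner ℝ w (coordVec p y (EuclideanSpace.single j 1))) := by
  have hw : w ∈ Submodule.span ℝ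
    (range fun i : Fin n => coordVec p y (EuclideanSpace.single i 1)) := span_coordVec hy ▸ trivial
  obtain ⟨c, rfl⟩ := (Submodule.mem_span_range_iff_exists_fun ℝ).1 hw
  have h1 : ∀ j, inner ℝ (∑ i, c i • coordVec p y (EuclideanSpace.single i 1))
      (coordVec p y (EuclideanSpace.single j 1)) = (gram p y).mulVec c j := by
    intro j
    simp only [sum_inner, inner_smul_left, Matrix.mulVec, dotProduct, gram, Matrix.of_apply]
    refine Finset.sum_congr rfl fun i _ => ?_
    rw [real_inner_comm, mul_comm]
    rfl
  have h2 : ∀ i, ∑ j, (gram p y)⁻¹ i j * (gram p y).mulVec c j = c i := by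
    intro i
    have : (gram p y)⁻¹.mulVec ((gram p y).mulVec c) = c := by
      rw [Matrix.mulVec_mulVec, Matrix.nonsing_inv_mul _ (gram_det_pos hy).ne'.isUnit,
        Matrix.one_mulVec]
    exact congrFun this i
  simp only [h1, ← Finset.mul_sum, h2]
  simp only [inner_sum, inner_smul_right]
  exact Finset.sum_congr rfl fun i _ => mul_comm _ _

variable [IsContMDiffRiemannianBundle (𝓡 n) ∞ (𝔼 n) (fun x : M => TangentSpace (𝓡 n) x)]

lemma contMDiffOn_coordVec (p : M) (v : 𝔼 n) :
    ContMDiffOn (𝓡 n) ((𝓡 n).prod (𝓡 n)) ∞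
      (fun y => (⟨(chartAt (𝔼 n) p).symm y, coordVec p y v⟩ : TangentBundle (𝓡 n) M))
      (chartAt (𝔼 n) p).target := by
  have h := (contMDiffOn_chart_symm' p).contMDiffOn_tangentMapWithin (m := ∞) (by simp)
    (chartAt (𝔼 n) p).open_target.uniqueMDiffOn
  have h2 : ContMDiff (𝓡 n) ((𝓡 n).prod (𝓡 n)) ∞
      (fun y : 𝔼 n => (⟨y, v⟩ : TangentBundle (𝓡 n) (𝔼 n))) := 
    contMDiff_vectorSpace_iff_contDiff.2 contDiff_const
  refine (h.comp h2.contMDiffOn (fun y hy => hy)).congr fun y hy => ?_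
  simp only [Function.comp, tangentMapWithin]
  rw [mfderivWithin_of_isOpen (chartAt (𝔼 n) p).open_target hy]
  rfl

lemma continuousOn_inner_coordVec (p : M) (v w : 𝔼 n) :
    ContinuousOn (fun y => inner ℝ (coordVec p y v) (coordVec p y w)) (chartAt (𝔼 n) p).target :=
  (ContMDiffOn.inner_bundle (contMDiffOn_coordVec p v) (contMDiffOn_coordVec p w)).continuousOn

lemma continuousOn_gram (p : M) : ContinuousOn (gram p) (chartAt (𝔼 n) p).target := by
  refine continuousOn_pi.2 fun i => continuousOn_pi.2 fun j => ?_
  exact continuousOn_inner_coordVec p _ _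

/-- Cramer's formula, with a determinant that does not vanish on the chart target. -/
lemma continuousOn_gram_inv (p : M) (i j : Fin n) :
    ContinuousOn (fun y => (gram p y)⁻¹ i j) (chartAt (𝔼 n) p).target := by
  have : ContinuousOn (fun y => ((gram p y).det)⁻¹ * (gram p y).adjugate i j)
      (chartAt (𝔼 n) p).target := by
    refine ContinuousOn.mul (ContinuousOn.inv₀ ?_ fun y hy => (gram_det_pos hy).ne') ?_
    · exact (continuous_id.matrix_det).comp_continuousOn (continuousOn_gram p)
    · exact ((continuous_id.matrix_adjugate).matrix_elem i j).comp_continuousOn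
        (continuousOn_gram p)
  refine this.congr fun y hy => ?_
  simp [Matrix.inv_def]

end ChartGeometry

/-! ### The Riemannian volume: independence of the chart, null sets, local finiteness. -/

section Volume

variable {n : ℕ} {M : Type*} [TopologicalSpace M] [ChartedSpace (𝔼 n) M]

/-- The linear map `v ↦ coordVec p y v` with values in the model space. -/
def coordMapModel (p : M) (y : 𝔼 n) : (𝔼 n) →L[ℝ] (𝔼 n) :=
  mfderiv (𝓡 n) (𝓡 n) (chartAt (𝔼 n) p).symm y

/-- The transition map from the chart at `p` to the chart at `q`. -/
def transition (p q : M) (y : 𝔼 n) : 𝔼 n := chartAt (𝔼 n) q ((chartAt (𝔼 n) p).symm y)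

section Transition

variable [IsManifold (𝓡 n) ∞ M]

lemma mdifferentiableAt_transition {p q : M} {y : 𝔼 n} (hy : y ∈ (chartAt (𝔼 n) p).target)
    (hq : (chartAt (𝔼 n) p).symm y ∈ (chartAt (𝔼 n) q).source) :
    MDifferentiableAt (𝓡 n) (𝓡 n) (transition p q) y :=
  (mdifferentiableAt_chart hq).comp y (mdifferentiableAt_chart_symm hy)

lemma coordMapModel_transition {p q : M} {y : 𝔼 n} (hy : y ∈ (chartAt (𝔼 n) p).target)
    (hq : (chartAt (𝔼 n) p).symm y ∈ (chartAt (𝔼 n) q).source) :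
    coordMapModel p y =
      (coordMapModel q (transition p q y)).comp (fderiv ℝ (transition p q) y) := by
  have hT := mdifferentiableAt_transition hy hq
  have h1 : transition p q y ∈ (chartAt (𝔼 n) q).target := (chartAt (𝔼 n) q).map_source hq
  have h2 := mfderiv_comp y (mdifferentiableAt_chart_symm h1) hT
  have h3 : ((chartAt (𝔼 n) q).symm ∘ transition p q) =ᶠ[𝓝 y] (chartAt (𝔼 n) p).symm := by
    have : (chartAt (𝔼 n) p).target ∩ (chartAt (𝔼 n) p).symm ⁻¹' (chartAt (𝔼 n) q).source ∈ 𝓝 y :=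
      ((chartAt (𝔼 n) p).isOpen_inter_preimage_symm (chartAt (𝔼 n) q).open_source).mem_nhds ⟨hy, hq⟩
    filter_upwards [this] with z hz
    exact (chartAt (𝔼 n) q).left_inv hz.2
  have h4 := h3.mfderiv_eq (I := 𝓡 n) (I' := 𝓡 n)
  rw [← mfderiv_eq_fderiv]
  ext1 v
  exact (DFunLike.congr_fun h4 v).symm.trans (DFunLike.congr_fun h2 v)

variable [RiemannianBundle (fun x : M => TangentSpace (𝓡 n) x)]

/-- `J` is the Jacobian matrix of the transition map: the chain rule expresses the coordinate fields
of one chart through those of the other, and the metric is bilinear. -/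
lemma gram_transition {p q : M} {y : 𝔼 n} (hy : y ∈ (chartAt (𝔼 n) p).target)
    (hq : (chartAt (𝔼 n) p).symm y ∈ (chartAt (𝔼 n) q).source) :
    ∃ J : Matrix (Fin n) (Fin n) ℝ, J.det = (fderiv ℝ (transition p q) y).det ∧
      gram p y = J.transpose * gram q (transition p q y) * J := by
  let b := (EuclideanSpace.basisFun (Fin n) ℝ).toBasis
  set T := fderiv ℝ (transition p q) y
  refine ⟨LinearMap.toMatrix b b T.toLinearMap, LinearMap.det_toMatrix b _, ?_⟩
  set J := LinearMap.toMatrix b b T.toLinearMap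
  have hJ : ∀ i, T (EuclideanSpace.single i 1) = ∑ k, J k i • EuclideanSpace.single k 1 := by
    intro i
    refine (b.sum_repr _).symm.trans (Finset.sum_congr rfl fun k _ => ?_)
    simp [J, b, LinearMap.toMatrix_apply]
  have hx : (chartAt (𝔼 n) q).symm (transition p q y) = (chartAt (𝔼 n) p).symm y :=
    (chartAt (𝔼 n) q).left_inv hq
  -- The two Gram matrices live in tangent spaces at points that are equal only propositionally.
  -- Generalizing over both points, with linear maps into the model space, lets the equality be
  -- eliminated.
  have key : ∀ (x x' : M) (_ : x = x') (A B : (𝔼 n) →L[ℝ] (𝔼 n)) (_ : B = A.comp T) (i j : Fin n),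
      @inner ℝ (TangentSpace (𝓡 n) x') _ (B (EuclideanSpace.single i 1))
        (B (EuclideanSpace.single j 1)) =
      ∑ l, (∑ k, J k i * @inner ℝ (TangentSpace (𝓡 n) x) _ (A (EuclideanSpace.single k 1))
        (A (EuclideanSpace.single l 1))) * J l j := by
    rintro x _ rfl A _ rfl i j
    have hs : ∀ i, (A.comp T) (EuclideanSpace.single i 1) =
        ∑ k, J k i • A (EuclideanSpace.single k 1) := by
      intro i
      simp [hJ]
    rw [hs, hs]
    refine (inner_sum (𝕜 := ℝ) (E := TangentSpace (𝓡 n) x) _ _ _).trans ?_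
    refine Finset.sum_congr rfl fun l _ => ?_
    refine (inner_smul_right (𝕜 := ℝ) (E := TangentSpace (𝓡 n) x) _ _ _).trans ?_
    rw [mul_comm]
    congr 1
    refine (sum_inner (𝕜 := ℝ) (E := TangentSpace (𝓡 n) x) _ _ _).trans ?_
    refine Finset.sum_congr rfl fun k _ => ?_
    exact real_inner_smul_left (F := TangentSpace (𝓡 n) x) _ _ _
  ext i j
  simp only [Matrix.mul_apply, Matrix.transpose_apply]
  exact key _ _ hx (coordMapModel q (transition p q y)) (coordMapModel p y)
    (coordMapModel_transition hy hq) i j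

lemma sqrt_det_gram_transition {p q : M} {y : 𝔼 n} (hy : y ∈ (chartAt (𝔼 n) p).target)
    (hq : (chartAt (𝔼 n) p).symm y ∈ (chartAt (𝔼 n) q).source) :
    Real.sqrt (gram p y).det =
      |(fderiv ℝ (transition p q) y).det| * Real.sqrt (gram q (transition p q y)).det := by
  obtain ⟨J, hJ, h⟩ := gram_transition hy hq
  rw [h, Matrix.det_mul, Matrix.det_mul, Matrix.det_transpose, hJ, mul_right_comm, ← sq,
    Real.sqrt_mul (sq_nonneg _), Real.sqrt_sq_eq_abs]

end Transition

lemma measurableSet_target_inter_preimage [MeasurableSpace M] [BorelSpace M] (p : M) {s : Set M}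
    (hs : MeasurableSet s) :
    MeasurableSet ((chartAt (𝔼 n) p).target ∩ (chartAt (𝔼 n) p).symm ⁻¹' s) := by
  have h := (continuousOn_iff_continuous_domRestrict.1
    (chartAt (𝔼 n) p).continuousOn_symm).measurable hs
  have := (chartAt (𝔼 n) p).open_target.measurableSet.subtype_image h
  convert this using 1
  ext y
  simp [and_comm]

variable [RiemannianBundle (fun x : M => TangentSpace (𝓡 n) x)]

lemma chartVolume_apply [MeasurableSpace M] [BorelSpace M] [SecondCountableTopology M] (p : M)
    {s : Set M} (hs : MeasurableSet s) :
    chartVolume (n := n) p s = ∫⁻ y in (chartAt (𝔼 n) p).target ∩ (chartAt (𝔼 n) p).symm ⁻¹' s,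
      ENNReal.ofReal (Real.sqrt (gram p y).det) := by
  have h : AEMeasurable (chartAt (𝔼 n) p).symm (volume.restrict (chartAt (𝔼 n) p).target) :=
    (chartAt (𝔼 n) p).continuousOn_symm.aemeasurable (chartAt (𝔼 n) p).open_target.measurableSet
  rw [chartVolume, Measure.map_apply_of_aemeasurable
    (h.mono_ac (withDensity_absolutelyContinuous _ _)) hs, withDensity_apply',
    Measure.restrict_restrict' (chartAt (𝔼 n) p).open_target.measurableSet, inter_comm]

variable [IsManifold (𝓡 n) ∞ M]

/-- Passing between charts multiplies the density by the absolute Jacobian, which is the factor in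
the change of variables formula. -/
lemma chartVolume_eq_chartVolume [MeasurableSpace M] [BorelSpace M] [SecondCountableTopology M]
    (p q : M) {s : Set M} (hs : MeasurableSet s) (hp : s ⊆ (chartAt (𝔼 n) p).source)
    (hq : s ⊆ (chartAt (𝔼 n) q).source) :
    chartVolume (n := n) p s = chartVolume (n := n) q s := by
  rw [chartVolume_apply p hs, chartVolume_apply q hs]
  set S := (chartAt (𝔼 n) p).target ∩ (chartAt (𝔼 n) p).symm ⁻¹' s
  have himg : (chartAt (𝔼 n) q).target ∩ (chartAt (𝔼 n) q).symm ⁻¹' s = transition p q '' S := by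
    ext z
    constructor
    · rintro ⟨hz, hzs⟩
      refine ⟨chartAt (𝔼 n) p ((chartAt (𝔼 n) q).symm z), ⟨(chartAt (𝔼 n) p).map_source (hp hzs), ?_⟩, ?_⟩
      · rw [mem_preimage, (chartAt (𝔼 n) p).left_inv (hp hzs)]
        exact hzs
      · rw [transition, (chartAt (𝔼 n) p).left_inv (hp hzs), (chartAt (𝔼 n) q).right_inv hz]
    · rintro ⟨y, ⟨-, hy⟩, rfl⟩
      refine ⟨(chartAt (𝔼 n) q).map_source (hq hy), ?_⟩
      rw [mem_preimage, transition, (chartAt (𝔼 n) q).left_inv (hq hy)]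
      exact hy
  have hinj : InjOn (transition p q) S := by
    intro y hy z hz h
    exact (chartAt (𝔼 n) p).symm.injOn hy.1 hz.1 ((chartAt (𝔼 n) q).injOn (hq hy.2) (hq hz.2) h)
  have hS : MeasurableSet S := measurableSet_target_inter_preimage p hs
  rw [himg, lintegral_image_eq_lintegral_abs_det_fderiv_mul volume hS
    (f' := fderiv ℝ (transition p q)) (fun y hy => ((mdifferentiableAt_iff_differentiableAt.1
      (mdifferentiableAt_transition hy.1 (hq hy.2))).hasFDerivAt).hasFDerivWithinAt) hinj]
  refine setLIntegral_congr_fun hS fun y hy => ?_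
  rw [sqrt_det_gram_transition hy.1 (hq hy.2), ENNReal.ofReal_mul (abs_nonneg _)]

variable [MeasurableSpace M] [BorelSpace M] [SecondCountableTopology M] [Nonempty M]

/-- The Riemannian volume is `√(det gᵢⱼ) dx¹ ⋯ dxⁿ` in every chart. -/
lemma riemVolume_apply (p : M) {s : Set M} (hs : MeasurableSet s)
    (hp : s ⊆ (chartAt (𝔼 n) p).source) :
    riemVolume n M s = ∫⁻ y in (chartAt (𝔼 n) p).target ∩ (chartAt (𝔼 n) p).symm ⁻¹' s,
      ENNReal.ofReal (Real.sqrt (gram p y).det) := by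
  have hD : ∀ i, MeasurableSet
      (disjointed (fun j => (chartAt (𝔼 n) (chartCentre n M j)).source) i) := fun i =>
    MeasurableSet.disjointed (fun j => (chartAt (𝔼 n) (chartCentre n M j)).open_source.measurableSet) i
  have hcov : ⋃ i, disjointed (fun j => (chartAt (𝔼 n) (chartCentre n M j)).source) i = univ := by
    rw [iUnion_disjointed]
    exact (exists_chart_cover n M).choose_spec
  rw [← chartVolume_apply p hs, riemVolume, Measure.sum_apply _ hs]
  have : ∀ i, (chartVolume (n := n) (chartCentre n M i)).restrict
      (disjointed (fun j => (chartAt (𝔼 n) (chartCentre n M j)).source) i) s =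
      chartVolume (n := n) p (s ∩ disjointed (fun j => (chartAt (𝔼 n) (chartCentre n M j)).source) i) := by
    intro i
    rw [Measure.restrict_apply hs]
    exact chartVolume_eq_chartVolume _ _ (hs.inter (hD i))
      (inter_subset_right.trans (disjointed_subset _ _)) (inter_subset_left.trans hp)
  simp_rw [this]
  rw [← measure_iUnion _ (fun i => hs.inter (hD i)), ← inter_iUnion, hcov, inter_univ]
  intro i j hij
  exact ((disjoint_disjointed _) hij).mono inter_subset_right inter_subset_right

/-- Null sets of the volume are null sets in the chart. -/
lemma volume_target_inter_preimage_eq_zero [IsContMDiffRiemannianBundle (𝓡 n) ∞ (𝔼 n)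
    (fun x : M => TangentSpace (𝓡 n) x)] (p : M) {s : Set M} (hp : s ⊆ (chartAt (𝔼 n) p).source)
    (h : riemVolume n M s = 0) :
    volume ((chartAt (𝔼 n) p).target ∩ (chartAt (𝔼 n) p).symm ⁻¹' s) = 0 := by
  set t := toMeasurable (riemVolume n M) s ∩ (chartAt (𝔼 n) p).source
  have ht : MeasurableSet t :=
    (measurableSet_toMeasurable _ _).inter (chartAt (𝔼 n) p).open_source.measurableSet
  have hst : s ⊆ t := subset_inter (subset_toMeasurable _ _) hp
  have ht0 : riemVolume n M t = 0 :=
    measure_mono_null inter_subset_left ((measure_toMeasurable _).trans h)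
  refine measure_mono_null (inter_subset_inter_right _ (preimage_mono hst)) ?_
  rw [riemVolume_apply p ht inter_subset_right] at ht0
  -- The density is positive on the chart target, so a vanishing integral forces a null domain.
  rw [setLIntegral_eq_zero_iff' (measurableSet_target_inter_preimage p ht)] at ht0
  · refine measure_mono_null (fun y hy => ?_) ht0
    simp only [mem_compl_iff, mem_ofPred_eq, Classical.not_imp]
    exact ⟨hy, (ENNReal.ofReal_pos.2 (Real.sqrt_pos.2 (gram_det_pos hy.1))).ne'⟩
  · have hcont : ContinuousOn (fun y => (gram p y).det) (chartAt (𝔼 n) p).target :=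
      (continuous_id.matrix_det).comp_continuousOn (continuousOn_gram p)
    exact (((Real.continuous_sqrt.comp_continuousOn hcont).aemeasurable
      (chartAt (𝔼 n) p).open_target.measurableSet).mono_measure
      (Measure.restrict_mono inter_subset_left le_rfl)).ennreal_ofReal

/-- Null sets of the chart are null sets of the volume. -/
lemma riemVolume_source_inter_preimage_eq_zero (p : M) {N : Set (𝔼 n)}
    (h : volume (N ∩ (chartAt (𝔼 n) p).target) = 0) :
    riemVolume n M ((chartAt (𝔼 n) p).source ∩ chartAt (𝔼 n) p ⁻¹' N) = 0 := by
  set N' := toMeasurable volume (N ∩ (chartAt (𝔼 n) p).target)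
  have hN' : volume N' = 0 := (measure_toMeasurable _).trans h
  have hm : MeasurableSet ((chartAt (𝔼 n) p).source ∩ chartAt (𝔼 n) p ⁻¹' N') := by
    have h := (continuousOn_iff_continuous_domRestrict.1
      (chartAt (𝔼 n) p).continuousOn).measurable (measurableSet_toMeasurable volume
        (N ∩ (chartAt (𝔼 n) p).target))
    have := (chartAt (𝔼 n) p).open_source.measurableSet.subtype_image h
    convert this using 1
    ext y
    simp [N', and_comm]
  refine measure_mono_null (t := (chartAt (𝔼 n) p).source ∩ chartAt (𝔼 n) p ⁻¹' N') ?_ ?_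
  · rintro x ⟨hx, hxN⟩
    exact ⟨hx, subset_toMeasurable _ _ ⟨hxN, (chartAt (𝔼 n) p).map_source hx⟩⟩
  rw [riemVolume_apply p hm inter_subset_left]
  refine setLIntegral_measure_zero _ _ (measure_mono_null ?_ hN')
  rintro y ⟨hy, -, hyN⟩
  rwa [mem_preimage, (chartAt (𝔼 n) p).right_inv hy] at hyN

/-- This lets a.e.-measurability in coordinates be pulled back to the manifold. -/
lemma map_chart_absolutelyContinuous (p : M) :
    Measure.map (chartAt (𝔼 n) p) ((riemVolume n M).restrict (chartAt (𝔼 n) p).source) ≪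
      volume.restrict (chartAt (𝔼 n) p).target := by
  have h : AEMeasurable (chartAt (𝔼 n) p) ((riemVolume n M).restrict (chartAt (𝔼 n) p).source) :=
    (chartAt (𝔼 n) p).continuousOn.aemeasurable (chartAt (𝔼 n) p).open_source.measurableSet
  refine Measure.AbsolutelyContinuous.mk fun N hN hN0 => ?_
  rw [Measure.map_apply_of_aemeasurable h hN,
    Measure.restrict_apply' (chartAt (𝔼 n) p).open_source.measurableSet, inter_comm]
  rw [Measure.restrict_apply hN] at hN0
  exact riemVolume_source_inter_preimage_eq_zero p hN0

lemma isLocallyFiniteMeasure_riemVolume [IsContMDiffRiemannianBundle (𝓡 n) ∞ (𝔼 n)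
    (fun x : M => TangentSpace (𝓡 n) x)] : IsLocallyFiniteMeasure (riemVolume n M) := by
  refine ⟨fun x => ?_⟩
  have hx : chartAt (𝔼 n) x x ∈ (chartAt (𝔼 n) x).target := mem_chart_target _ x
  obtain ⟨r, hr, hrt⟩ := Metric.nhds_basis_closedBall.mem_iff.1
    ((chartAt (𝔼 n) x).open_target.mem_nhds hx)
  have hcont : ContinuousOn (fun y => (gram x y).det) (chartAt (𝔼 n) x).target :=
    (continuous_id.matrix_det).comp_continuousOn (continuousOn_gram x)
  obtain ⟨B, hB⟩ := (isCompact_closedBall (chartAt (𝔼 n) x x) r).exists_bound_of_continuousOn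
    (Real.continuous_sqrt.comp_continuousOn (hcont.mono hrt))
  set U := (chartAt (𝔼 n) x).source ∩ chartAt (𝔼 n) x ⁻¹' Metric.ball (chartAt (𝔼 n) x x) r
  have hU : IsOpen U := (chartAt (𝔼 n) x).isOpen_inter_preimage Metric.isOpen_ball
  refine ⟨U, hU.mem_nhds ⟨mem_chart_source _ x, Metric.mem_ball_self hr⟩, ?_⟩
  rw [riemVolume_apply x hU.measurableSet inter_subset_left]
  have hsub : (chartAt (𝔼 n) x).target ∩ (chartAt (𝔼 n) x).symm ⁻¹' U ⊆
      Metric.closedBall (chartAt (𝔼 n) x x) r := by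
    rintro y ⟨hy, -, hyU⟩
    rw [mem_preimage, (chartAt (𝔼 n) x).right_inv hy] at hyU
    exact Metric.ball_subset_closedBall hyU
  calc _ ≤ ∫⁻ y in Metric.closedBall (chartAt (𝔼 n) x x) r,
        ENNReal.ofReal (Real.sqrt (gram x y).det) := lintegral_mono_set hsub
    _ ≤ ∫⁻ _ in Metric.closedBall (chartAt (𝔼 n) x x) r, ENNReal.ofReal B :=
        setLIntegral_mono' Metric.isClosed_closedBall.measurableSet fun y hy =>
          ENNReal.ofReal_le_ofReal ((le_abs_self _).trans (hB y hy))
    _ < ⊤ := by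
        rw [setLIntegral_const]
        exact ENNReal.mul_lt_top ENNReal.ofReal_lt_top
          (isCompact_closedBall (chartAt (𝔼 n) x x) r).measure_lt_top

end Volume

/-! ### Mollification of functions with bounded weak derivatives in Euclidean space. -/

section Mollification

open Filter ContinuousLinearMap
open scoped Convolution

variable {E : Type*} [NormedAddCommGroup E] [InnerProductSpace ℝ E] [FiniteDimensional ℝ E]
  [MeasurableSpace E] [BorelSpace E]

/-- The directional derivative of a mollification is the mollification of the weak derivative. -/
lemma fderiv_normed_convolution_apply (φ : ContDiffBump (0 : E)) {L W : Set E} {f g : E → ℝ} {v : E}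
    (hL : IsCompact L) (hLW : L ⊆ W) (hf : ContinuousOn f L)
    (hw : ∀ η : E → ℝ, ContDiff ℝ ∞ η → HasCompactSupport η → tsupport η ⊆ W →
      ∫ y, f y * fderiv ℝ η y v = - ∫ y, g y * η y)
    {y : E} (hy : Metric.closedBall y φ.rOut ⊆ L) :
    fderiv ℝ (φ.normed volume ⋆[lsmul ℝ ℝ, volume] L.indicator f) y v =
      ∫ t, g t * φ.normed volume (y - t) := by
  have hint : LocallyIntegrable (L.indicator f) volume :=
    ((hf.integrableOn_compact hL).integrable_indicator hL.measurableSet).locallyIntegrable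
  have hsm : ContDiff ℝ ∞ (φ.normed volume) := φ.contDiff_normed
  have hcs : HasCompactSupport (φ.normed volume) := φ.hasCompactSupport_normed
  have hflip : φ.normed volume ⋆[lsmul ℝ ℝ, volume] L.indicator f =
      L.indicator f ⋆[(lsmul ℝ ℝ).flip, volume] φ.normed volume := (convolution_flip _).symm
  rw [hflip, (hcs.hasFDerivAt_convolution_right _ hint (hsm.of_le (by simp)) y).fderiv,
    convolution_precompR_apply _ hint (hcs.fderiv ℝ) (hsm.continuous_fderiv (by simp))]
  -- The reflected kernel centred at `y` is the test function for the weak derivative; the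
  -- reflection produces the sign in `hd`.
  set η : E → ℝ := fun t => φ.normed volume (y - t)
  have hη : ContDiff ℝ ∞ η := hsm.comp (contDiff_const.sub contDiff_id)
  have hsub : tsupport η ⊆ Metric.closedBall y φ.rOut := by
    refine closure_minimal ?_ Metric.isClosed_closedBall
    intro t ht
    have h1 : y - t ∈ Function.support (φ.normed volume) := ht
    rw [φ.support_normed_eq] at h1
    rw [Metric.mem_closedBall, dist_comm, dist_eq_norm]
    exact (mem_ball_zero_iff.1 h1).le
  have hηc : HasCompactSupport η :=
    (isCompact_closedBall y φ.rOut).of_isClosed_subset (isClosed_tsupport η) hsub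
  have hd : ∀ t, fderiv ℝ η t v = - fderiv ℝ (φ.normed volume) (y - t) v := by
    intro t
    have h1 := (hsm.differentiable (by simp) (y - t)).hasFDerivAt.comp t
      ((hasFDerivAt_const y t).sub (hasFDerivAt_id t))
    have h2 : fderiv ℝ η t = _ := h1.fderiv
    rw [h2]
    simp
  have h := hw η hη hηc (hsub.trans (hy.trans hLW))
  rw [neg_eq_iff_eq_neg.symm] at h
  rw [← h, convolution_def, ← integral_neg]
  refine integral_congr_ae (Eventually.of_forall fun t => ?_)
  simp only [ContinuousLinearMap.flip_apply, lsmul_apply, smul_eq_mul]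
  -- The kernel is supported in a ball inside `L`, so cutting `f` off outside `L` changes nothing.
  by_cases ht : t ∈ L
  · rw [indicator_of_mem ht, hd]
    ring
  · have : fderiv ℝ η t = 0 := by
      by_contra hne
      exact ht (hy (hsub (support_fderiv_subset ℝ hne)))
    rw [indicator_of_notMem ht, this]
    have h3 := hd t
    rw [this, zero_apply] at h3
    simp

/-- A continuous function with locally bounded weak derivatives is, near a compact set, a uniform
limit of smooth functions whose derivatives are bounded and converge almost everywhere. -/
lemma exists_mollified_seq {W K : Set E} (hW : IsOpen W) (hK : IsCompact K) (hKW : K ⊆ W)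
    {f : E → ℝ} {g : E → E → ℝ} (hf : ContinuousOn f W)
    (hg : ∀ v, LocallyIntegrableOn (g v) W volume)
    (hw : ∀ v, ∀ η : E → ℝ, ContDiff ℝ ∞ η → HasCompactSupport η → tsupport η ⊆ W →
      ∫ y, f y * fderiv ℝ η y v = - ∫ y, g v y * η y)
    (hb : ∀ v, ∀ L ⊆ W, IsCompact L → ∃ B, ∀ᵐ y ∂volume.restrict L, |g v y| ≤ B) :
    ∃ F : ℕ → E → ℝ, (∀ k, ContDiff ℝ ∞ (F k)) ∧
      (∀ k, ∀ y ∈ K, |F k y - f y| ≤ 1 / ((k : ℝ) + 1)) ∧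
      (∀ v, ∀ᵐ y, y ∈ K → Tendsto (fun k => fderiv ℝ (F k) y v) atTop (𝓝 (g v y))) ∧
      ∀ v, ∃ B, ∀ k, ∀ y ∈ K, |fderiv ℝ (F k) y v| ≤ B := by
  obtain ⟨δ, hδ, hLW⟩ := hK.exists_cthickening_subset_open hW hKW
  set L := Metric.cthickening δ K
  have hL : IsCompact L := hK.cthickening
  have hfL : ContinuousOn f L := hf.mono hLW
  have huc := Metric.uniformContinuousOn_iff_le.1 (hL.uniformContinuousOn_of_continuous hfL)
  choose d hd hfd using fun k : ℕ => huc (1 / ((k : ℝ) + 1)) (by positivity)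
  -- The bound `δ` keeps the balls inside `L`, `d k` controls the oscillation of `f` by `1/(k+1)`,
  -- and `1/(k+1)` drives the radii to zero.
  let r : ℕ → ℝ := fun k => min (min δ (d k)) (1 / ((k : ℝ) + 1))
  have hr : ∀ k, 0 < r k := fun k => lt_min (lt_min hδ (hd k)) (by positivity)
  -- The fixed ratio 2 of outer to inner radius is the nondegeneracy needed for Lebesgue
  -- differentiation.
  let φ : ℕ → ContDiffBump (0 : E) := fun k => ⟨r k / 2, r k, half_pos (hr k), half_lt_self (hr k)⟩
  have hball : ∀ k, ∀ y ∈ K, Metric.closedBall y (φ k).rOut ⊆ L := fun k y hy =>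
    (Metric.closedBall_subset_closedBall ((min_le_left _ _).trans (min_le_left _ _))).trans
      (Metric.closedBall_subset_cthickening hy δ)
  have hr0 : Tendsto (fun k => (φ k).rOut) atTop (𝓝 0) :=
    squeeze_zero (fun k => (hr k).le) (fun k => min_le_right _ _)
      tendsto_one_div_add_atTop_nhds_zero_nat
  have hrb : ∀ᶠ k in atTop, (φ k).rOut ≤ 2 * (φ k).rIn :=
    Eventually.of_forall fun k => by
      change r k ≤ 2 * (r k / 2)
      linarith
  have hfi : Integrable (L.indicator f) volume :=
    (hfL.integrableOn_compact hL).integrable_indicator hL.measurableSet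
  have hgi : ∀ v, Integrable (L.indicator (g v)) volume := fun v =>
    (((hg v).mono_set hLW).integrableOn_isCompact hL).integrable_indicator hL.measurableSet
  have hder : ∀ k v, ∀ y ∈ K,
      fderiv ℝ ((φ k).normed volume ⋆[lsmul ℝ ℝ, volume] L.indicator f) y v =
        ((φ k).normed volume ⋆[lsmul ℝ ℝ, volume] L.indicator (g v)) y := by
    intro k v y hy
    rw [fderiv_normed_convolution_apply (φ k) hL hLW hfL (hw v) (hball k y hy),
      convolution_lsmul_swap]
    refine integral_congr_ae (Eventually.of_forall fun t => ?_)
    simp only [smul_eq_mul]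
    by_cases ht : t ∈ L
    · rw [indicator_of_mem ht, mul_comm]
    · have : (φ k).normed volume (y - t) = 0 := by
        by_contra hne
        have h1 : y - t ∈ Function.support ((φ k).normed volume) := hne
        rw [(φ k).support_normed_eq, mem_ball_zero_iff] at h1
        refine ht (hball k y hy ?_)
        rw [Metric.mem_closedBall, dist_comm, dist_eq_norm]
        exact h1.le
      rw [this]
      simp
  refine ⟨fun k => (φ k).normed volume ⋆[lsmul ℝ ℝ, volume] L.indicator f, fun k => ?_,
    fun k y hy => ?_, fun v => ?_, fun v => ?_⟩
  · exact (φ k).hasCompactSupport_normed.contDiff_convolution_left _ (φ k).contDiff_normed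
      hfi.locallyIntegrable
  · have hyL : y ∈ L := hball k y hy (Metric.mem_closedBall_self (hr k).le)
    have := (φ k).dist_normed_convolution_le (μ := volume) (x₀ := y) (g := L.indicator f)
      (ε := 1 / ((k : ℝ) + 1)) hfi.aestronglyMeasurable (fun x hx => by
        have hxL : x ∈ L := hball k y hy (Metric.ball_subset_closedBall hx)
        rw [indicator_of_mem hxL, indicator_of_mem hyL]
        exact hfd k x hxL y hyL
          ((Metric.mem_ball.1 hx).le.trans ((min_le_left _ _).trans (min_le_right _ _))))
    rwa [indicator_of_mem hyL, Real.dist_eq] at this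
  · filter_upwards [ContDiffBump.ae_convolution_tendsto_right_of_locallyIntegrable
      (μ := (volume : Measure E)) (l := atTop) (φ := φ) hr0 hrb (hgi v).locallyIntegrable] with y hy hyK
    have hyL : y ∈ L := hball 0 y hyK (Metric.mem_closedBall_self (hr 0).le)
    rw [indicator_of_mem hyL] at hy
    exact hy.congr fun k => (hder k v y hyK).symm
  · obtain ⟨B, hB⟩ := hb v L hLW hL
    set B' := max B 0
    -- The convolution estimate needs a bound at every point, so the weak derivative is replaced by
    -- an a.e. equal truncation.
    let g' : E → ℝ := fun y => max (-B') (min B' (L.indicator (g v) y))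
    have hae : L.indicator (g v) =ᵐ[volume] g' := by
      filter_upwards [(ae_restrict_iff' hL.measurableSet).1 hB] with y hy
      have : |L.indicator (g v) y| ≤ B' := by
        by_cases h : y ∈ L
        · rw [indicator_of_mem h]
          exact (hy h).trans (le_max_left _ _)
        · rw [indicator_of_notMem h, abs_zero]
          exact le_max_right _ _
      rw [abs_le] at this
      simp only [g']
      rw [min_eq_right this.2, max_eq_right this.1]
    refine ⟨B', fun k y hy => ?_⟩
    rw [hder k v y hy, convolution_congr _ EventuallyEq.rfl hae]
    have hB' : 0 ≤ B' := le_max_right _ _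
    have := dist_convolution_le (μ := (volume : Measure E)) (f := (φ k).normed volume) (x₀ := y)
      (R := (φ k).rOut) (ε := B') (z₀ := (0 : ℝ)) (g := g') hB' (φ k).support_normed_eq.subset
      (φ k).nonneg_normed (φ k).integral_normed ((hgi v).aestronglyMeasurable.congr hae)
      (fun x _ => by
        rw [dist_zero_right, Real.norm_eq_abs, abs_le]
        exact ⟨le_max_left _ _, max_le (by linarith) (min_le_left _ _)⟩)
    rwa [dist_zero_right, Real.norm_eq_abs] at this

end Mollification

/-! ### Gradients in coordinates and smooth approximation inside one chart. -/

section Local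

open Filter

variable {n : ℕ} {M : Type*} [TopologicalSpace M] [ChartedSpace (𝔼 n) M] [IsManifold (𝓡 n) ∞ M]

lemma continuousOn_fderiv_comp_chart_symm {ψ : M → ℝ} (hψ : ContMDiff (𝓡 n) 𝓘(ℝ, ℝ) ∞ ψ) (p : M)
    (v : 𝔼 n) : ContinuousOn (fun y => fderiv ℝ (fun z => ψ ((chartAt (𝔼 n) p).symm z)) y v)
      (chartAt (𝔼 n) p).target := by
  have h : ContDiffOn ℝ ∞ (fun z => ψ ((chartAt (𝔼 n) p).symm z)) (chartAt (𝔼 n) p).target :=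
    contMDiffOn_iff_contDiffOn.1 (hψ.comp_contMDiffOn (contMDiffOn_chart_symm' p))
  exact (h.continuousOn_fderiv_of_isOpen (chartAt (𝔼 n) p).open_target (by simp)).clm_apply
    continuousOn_const

lemma continuousOn_of_comp_chart_symm {k : M → ℝ} {p : M} {U : Set M}
    (h : ContinuousOn (fun y => k ((chartAt (𝔼 n) p).symm y))
      ((chartAt (𝔼 n) p).target ∩ (chartAt (𝔼 n) p).symm ⁻¹' U)) :
    ContinuousOn k ((chartAt (𝔼 n) p).source ∩ U) := by
  refine (h.comp ((chartAt (𝔼 n) p).continuousOn.mono inter_subset_left) fun x hx =>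
    ⟨(chartAt (𝔼 n) p).map_source hx.1, ?_⟩).congr fun x hx => ?_
  · rw [mem_preimage, (chartAt (𝔼 n) p).left_inv hx.1]
    exact hx.2
  · simp only [Function.comp]
    rw [(chartAt (𝔼 n) p).left_inv hx.1]

variable [RiemannianBundle (fun x : M => TangentSpace (𝓡 n) x)]

lemma inner_grad_coordVec {p : M} {y : 𝔼 n} (hy : y ∈ (chartAt (𝔼 n) p).target) {ψ : M → ℝ}
    (hψ : MDifferentiableAt (𝓡 n) 𝓘(ℝ, ℝ) ψ ((chartAt (𝔼 n) p).symm y)) (v : 𝔼 n) :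
    inner ℝ (grad ψ ((chartAt (𝔼 n) p).symm y)) (coordVec p y v) =
      fderiv ℝ (fun z => ψ ((chartAt (𝔼 n) p).symm z)) y v := by
  rw [real_inner_comm, inner_grad]
  exact mfderiv_coordVec hy hψ v

/-- `⟨X, ∇ψ⟩` in coordinates. -/
lemma inner_grad_eq_sum {p : M} {y : 𝔼 n} (hy : y ∈ (chartAt (𝔼 n) p).target) {ψ : M → ℝ}
    (hψ : MDifferentiableAt (𝓡 n) 𝓘(ℝ, ℝ) ψ ((chartAt (𝔼 n) p).symm y))
    (v : TangentSpace (𝓡 n) ((chartAt (𝔼 n) p).symm y)) :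
    inner ℝ v (grad ψ ((chartAt (𝔼 n) p).symm y)) =
      ∑ i, ∑ j, inner ℝ v (coordVec p y (EuclideanSpace.single i 1)) * ((gram p y)⁻¹ i j *
        fderiv ℝ (fun z => ψ ((chartAt (𝔼 n) p).symm z)) y (EuclideanSpace.single j 1)) := by
  rw [inner_eq_sum_gram_inv hy]
  simp only [inner_grad_coordVec hy hψ]

lemma inner_grad_mul {x : M} {f g : M → ℝ} (hf : MDifferentiableAt (𝓡 n) 𝓘(ℝ, ℝ) f x)
    (hg : MDifferentiableAt (𝓡 n) 𝓘(ℝ, ℝ) g x) (v : TangentSpace (𝓡 n) x) :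
    inner ℝ v (grad (fun x => f x * g x) x) =
      f x * inner ℝ v (grad g x) + g x * inner ℝ v (grad f x) := by
  simp only [inner_grad]
  have h : HasMFDerivAt (𝓡 n) 𝓘(ℝ, ℝ) (fun x => f x * g x) x _ := hf.hasMFDerivAt.mul hg.hasMFDerivAt
  rw [h.mfderiv]
  rfl

lemma inner_grad_add {x : M} {f g : M → ℝ} (hf : MDifferentiableAt (𝓡 n) 𝓘(ℝ, ℝ) f x)
    (hg : MDifferentiableAt (𝓡 n) 𝓘(ℝ, ℝ) g x) (v : TangentSpace (𝓡 n) x) :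
    inner ℝ v (grad (fun x => f x + g x) x) = inner ℝ v (grad f x) + inner ℝ v (grad g x) := by
  simp only [inner_grad]
  have h : HasMFDerivAt (𝓡 n) 𝓘(ℝ, ℝ) (fun x => f x + g x) x _ := hf.hasMFDerivAt.add hg.hasMFDerivAt
  rw [h.mfderiv]
  rfl

lemma inner_grad_comp {x : M} {f : M → ℝ} {h : ℝ → ℝ} (hf : MDifferentiableAt (𝓡 n) 𝓘(ℝ, ℝ) f x)
    {h' : ℝ} (hh : HasDerivAt h h' (f x)) (v : TangentSpace (𝓡 n) x) :
    inner ℝ v (grad (fun x => h (f x)) x) = h' * inner ℝ v (grad f x) := by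
  simp only [inner_grad]
  have h1 : HasMFDerivAt (𝓡 n) 𝓘(ℝ, ℝ) (h ∘ f) x _ :=
    HasMFDerivAt.comp x hh.hasFDerivAt.hasMFDerivAt hf.hasMFDerivAt
  refine (DFunLike.congr_fun h1.mfderiv v).trans ?_
  refine (ContinuousLinearMap.toSpanSingleton_apply _ _ _).trans ?_
  exact mul_comm (G := ℝ) _ _

lemma inner_grad_of_eventuallyEq {x : M} {f g : M → ℝ} (h : f =ᶠ[𝓝 x] g)
    (v : TangentSpace (𝓡 n) x) : inner ℝ v (grad f x) = inner ℝ v (grad g x) := by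
  simp only [inner_grad]
  rw [h.mfderiv_eq]
  rfl

lemma inner_grad_of_notMem_tsupport {x : M} {f : M → ℝ} (h : x ∉ tsupport f)
    (v : TangentSpace (𝓡 n) x) : inner ℝ v (grad f x) = 0 := by
  have h1 : f =ᶠ[𝓝 x] fun _ => (0 : ℝ) := notMem_tsupport_iff_eventuallyEq.1 h
  rw [inner_grad_of_eventuallyEq h1, inner_grad, mfderiv_const]
  rfl

section Continuity

variable [IsContMDiffRiemannianBundle (𝓡 n) ∞ (𝔼 n) (fun x : M => TangentSpace (𝓡 n) x)]

/-- In coordinates this is a finite sum of products of partial derivatives with entries of the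
inverse Gram matrix. -/
lemma continuous_inner_grad_grad {φ ψ : M → ℝ} (hφ : ContMDiff (𝓡 n) 𝓘(ℝ, ℝ) ∞ φ)
    (hψ : ContMDiff (𝓡 n) 𝓘(ℝ, ℝ) ∞ ψ) :
    Continuous fun x : M => inner ℝ (grad (n := n) φ x) (grad (n := n) ψ x) := by
  rw [continuous_iff_continuousAt]
  intro p
  have h : ContinuousOn (fun x : M => inner ℝ (grad (n := n) φ x) (grad (n := n) ψ x))
      ((chartAt (𝔼 n) p).source ∩ univ) := by
    apply continuousOn_of_comp_chart_symm
    rw [preimage_univ, inter_univ]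
    refine ContinuousOn.congr (f := fun y => ∑ i, ∑ j,
      fderiv ℝ (fun z => φ ((chartAt (𝔼 n) p).symm z)) y (EuclideanSpace.single i 1) *
        ((gram p y)⁻¹ i j *
          fderiv ℝ (fun z => ψ ((chartAt (𝔼 n) p).symm z)) y (EuclideanSpace.single j 1))) ?_ ?_
    · refine continuousOn_finsetSum _ fun i _ => continuousOn_finsetSum _ fun j _ => ?_
      exact (continuousOn_fderiv_comp_chart_symm hφ p _).mul
        ((continuousOn_gram_inv p i j).mul (continuousOn_fderiv_comp_chart_symm hψ p _))
    · intro y hy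
      simp only
      rw [inner_grad_eq_sum hy (hψ.mdifferentiableAt (by simp))]
      simp only [inner_grad_coordVec hy (hφ.mdifferentiableAt (by simp) (x := _))]
  rw [inter_univ] at h
  exact h.continuousAt (chart_source_mem_nhds _ p)

lemma continuous_norm_grad {φ : M → ℝ} (hφ : ContMDiff (𝓡 n) 𝓘(ℝ, ℝ) ∞ φ) :
    Continuous fun x : M => ‖grad (n := n) φ x‖ := by
  simp only [norm_eq_sqrt_real_inner]
  exact Real.continuous_sqrt.comp (continuous_inner_grad_grad hφ hφ)

end Continuity

variable [MeasurableSpace M] [BorelSpace M] [SecondCountableTopology M] [Nonempty M]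

/-- Almost everywhere in the chart domain, for the Lebesgue measure and for the volume. -/
lemma ae_chart_iff [IsContMDiffRiemannianBundle (𝓡 n) ∞ (𝔼 n) (fun x : M => TangentSpace (𝓡 n) x)]
    (p : M) {P : M → Prop} :
    (∀ᵐ y : 𝔼 n, y ∈ (chartAt (𝔼 n) p).target → P ((chartAt (𝔼 n) p).symm y)) ↔
      ∀ᵐ x ∂riemVolume n M, x ∈ (chartAt (𝔼 n) p).source → P x := by
  simp only [ae_iff, Classical.not_imp]
  constructor
  · intro h
    refine measure_mono_null ?_ (riemVolume_source_inter_preimage_eq_zero p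
      (N := {y | ¬ P ((chartAt (𝔼 n) p).symm y)}) (measure_mono_null ?_ h))
    · rintro x ⟨hx, hP⟩
      refine ⟨hx, ?_⟩
      change ¬ P _
      rwa [(chartAt (𝔼 n) p).left_inv hx]
    · rintro y ⟨hy, hyt⟩
      exact ⟨hyt, hy⟩
  · intro h
    refine measure_mono_null ?_ (volume_target_inter_preimage_eq_zero p (fun x hx => hx.1) h)
    rintro y ⟨hy, hP⟩
    exact ⟨hy, (chartAt (𝔼 n) p).map_target hy, hP⟩

lemma aestronglyMeasurable_of_chart {U : Set M} (hU : IsOpen U) (p : M) {k : M → ℝ}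
    (h : AEStronglyMeasurable (fun y => k ((chartAt (𝔼 n) p).symm y))
      (volume.restrict ((chartAt (𝔼 n) p).target ∩ (chartAt (𝔼 n) p).symm ⁻¹' U))) :
    AEStronglyMeasurable k ((riemVolume n M).restrict ((chartAt (𝔼 n) p).source ∩ U)) := by
  set W := (chartAt (𝔼 n) p).target ∩ (chartAt (𝔼 n) p).symm ⁻¹' U
  have hW : MeasurableSet W := ((chartAt (𝔼 n) p).isOpen_inter_preimage_symm hU).measurableSet
  have h1 : AEStronglyMeasurable (W.indicator fun y => k ((chartAt (𝔼 n) p).symm y)) volume :=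
    (aestronglyMeasurable_indicator_iff hW).2 h
  have h2 := (h1.mono_measure Measure.restrict_le_self).mono_ac
    (map_chart_absolutelyContinuous (n := n) p)
  have h3 := (h2.comp_aemeasurable ((chartAt (𝔼 n) p).continuousOn.aemeasurable
    (chartAt (𝔼 n) p).open_source.measurableSet)).mono_measure
      (Measure.restrict_mono inter_subset_left le_rfl :
        (riemVolume n M).restrict ((chartAt (𝔼 n) p).source ∩ U) ≤ _)
  refine h3.congr ?_
  refine (ae_restrict_iff' ((chartAt (𝔼 n) p).open_source.inter hU).measurableSet).2
    (Eventually.of_forall fun x hx => ?_)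
  have hxW : chartAt (𝔼 n) p x ∈ W := by
    refine ⟨(chartAt (𝔼 n) p).map_source hx.1, ?_⟩
    rw [mem_preimage, (chartAt (𝔼 n) p).left_inv hx.1]
    exact hx.2
  simp only [Function.comp, indicator_of_mem hxW]
  rw [(chartAt (𝔼 n) p).left_inv hx.1]

variable [IsContMDiffRiemannianBundle (𝓡 n) ∞ (𝔼 n) (fun x : M => TangentSpace (𝓡 n) x)]
  {U : Set M} {f b : M → ℝ} {Z : (x : M) → TangentSpace (𝓡 n) x}

/-- The coordinate components of `Z` are measurable because they are locally integrable; countably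
many charts cover `U`. -/
lemma aestronglyMeasurable_inner_grad (hU : IsOpen U) (hZ : IsWeakGradientOn U f Z) {ψ : M → ℝ}
    (hψ : ContMDiff (𝓡 n) 𝓘(ℝ, ℝ) ∞ ψ) :
    AEStronglyMeasurable (fun x => inner ℝ (Z x) (grad ψ x)) ((riemVolume n M).restrict U) := by
  obtain ⟨q, hq⟩ := exists_chart_cover n M
  have hUq : U = ⋃ i, (chartAt (𝔼 n) (q i)).source ∩ U := by
    rw [← iUnion_inter, hq, univ_inter]
  rw [hUq, aestronglyMeasurable_iUnion_iff]
  intro i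
  refine aestronglyMeasurable_of_chart hU (q i) ?_
  set p := q i
  set W := (chartAt (𝔼 n) p).target ∩ (chartAt (𝔼 n) p).symm ⁻¹' U
  have hW : MeasurableSet W := ((chartAt (𝔼 n) p).isOpen_inter_preimage_symm hU).measurableSet
  have : AEStronglyMeasurable (fun y => ∑ i, ∑ j,
      inner ℝ (Z ((chartAt (𝔼 n) p).symm y)) (coordVec p y (EuclideanSpace.single i 1)) *
        ((gram p y)⁻¹ i j * fderiv ℝ (fun z => ψ ((chartAt (𝔼 n) p).symm z)) y
          (EuclideanSpace.single j 1))) (volume.restrict W) := by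
    refine Finset.aestronglyMeasurable_fun_sum _ fun i _ =>
      Finset.aestronglyMeasurable_fun_sum _ fun j _ => ?_
    refine AEStronglyMeasurable.mul (hZ p _).2.1.aestronglyMeasurable ?_
    exact (((continuousOn_gram_inv p i j).mul
      (continuousOn_fderiv_comp_chart_symm hψ p _)).mono inter_subset_left).aestronglyMeasurable hW
  refine this.congr ((ae_restrict_iff' hW).2 (Eventually.of_forall fun y hy => ?_))
  exact (inner_grad_eq_sum hy.1 (hψ.mdifferentiableAt (by simp)) _).symm

/-- Products of `⟨Z, ∇ψ⟩` with continuous functions are integrable on compact sets. -/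
lemma integrableOn_mul_inner_grad [T2Space M] (hU : IsOpen U) (hZ : IsWeakGradientOn U f Z)
    (hb : Continuous b) (hZb : ∀ᵐ x ∂(riemVolume n M).restrict U, ‖Z x‖ = b x) {ψ : M → ℝ}
    (hψ : ContMDiff (𝓡 n) 𝓘(ℝ, ℝ) ∞ ψ) {g : M → ℝ} {K : Set M} (hK : IsCompact K) (hKU : K ⊆ U)
    (hg : ContinuousOn g K) :
    IntegrableOn (fun x => g x * inner ℝ (Z x) (grad ψ x)) K (riemVolume n M) := by
  have := isLocallyFiniteMeasure_riemVolume (n := n) (M := M)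
  have hc : ContinuousOn (fun x => g x * (b x * ‖grad (n := n) ψ x‖)) K :=
    hg.mul (hb.mul (continuous_norm_grad hψ)).continuousOn
  obtain ⟨B, hB⟩ := hK.exists_bound_of_continuousOn hc
  refine IntegrableOn.of_bound hK.measure_lt_top
    ((hg.aestronglyMeasurable hK.measurableSet).mul
      ((aestronglyMeasurable_inner_grad hU hZ hψ).mono_measure (Measure.restrict_mono hKU le_rfl)))
    B ?_
  filter_upwards [ae_restrict_mem hK.measurableSet, ae_restrict_of_ae_restrict_of_subset hKU hZb]
    with x hx hxb
  refine le_trans ?_ (hB x hx)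
  rw [norm_mul, norm_mul]
  refine mul_le_mul_of_nonneg_left ?_ (norm_nonneg _)
  refine (abs_real_inner_le_norm _ _).trans ?_
  rw [hxb]
  exact le_abs_self _

/-- Near a compact subset of a chart, a continuous function with bounded weak gradient `Z` is a
uniform limit of smooth functions `F k` with `⟨Z, ∇F k⟩` bounded and tending to `‖Z‖²` almost
everywhere. -/
lemma exists_smooth_seq (hU : IsOpen U) (hf : Continuous f) (hZ : IsWeakGradientOn U f Z)
    (hb : Continuous b) (hZb : ∀ᵐ x ∂(riemVolume n M).restrict U, ‖Z x‖ = b x) (p : M) {K : Set M}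
    (hK : IsCompact K) (hKp : K ⊆ (chartAt (𝔼 n) p).source) (hKU : K ⊆ U) :
    ∃ F : ℕ → M → ℝ,
      (∀ k, ContMDiffOn (𝓡 n) 𝓘(ℝ, ℝ) ∞ (F k) (chartAt (𝔼 n) p).source) ∧
      (∀ k, ∀ x ∈ K, |F k x - f x| ≤ 1 / ((k : ℝ) + 1)) ∧
      (∀ᵐ x ∂riemVolume n M, x ∈ K →
        Tendsto (fun k => inner ℝ (Z x) (grad (F k) x)) atTop (𝓝 (b x ^ 2))) ∧
      ∃ B, ∀ k, ∀ᵐ x ∂riemVolume n M, x ∈ K → |inner ℝ (Z x) (grad (F k) x)| ≤ B := by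
  set e := chartAt (𝔼 n) p with he
  set W := e.target ∩ e.symm ⁻¹' U
  have hW : IsOpen W := e.isOpen_inter_preimage_symm hU
  have hKW : e '' K ⊆ W := by
    rintro _ ⟨x, hx, rfl⟩
    refine ⟨e.map_source (hKp hx), ?_⟩
    rw [mem_preimage, e.left_inv (hKp hx)]
    exact hKU hx
  let g : (𝔼 n) → (𝔼 n) → ℝ := fun v y => inner ℝ (Z (e.symm y)) (coordVec p y v)
  have hae : ∀ᵐ y : 𝔼 n, y ∈ e.target → e.symm y ∈ U → ‖Z (e.symm y)‖ = b (e.symm y) := by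
    refine (ae_chart_iff p (P := fun x => x ∈ U → ‖Z x‖ = b x)).2 ?_
    filter_upwards [(ae_restrict_iff' hU.measurableSet).1 hZb] with x hx _ using hx
  have hgb : ∀ v, ∀ L ⊆ W, IsCompact L → ∃ B, ∀ᵐ y ∂volume.restrict L, |g v y| ≤ B := by
    -- Cauchy-Schwarz bounds a component of `Z` by `b` times the length of a coordinate field, which
    -- is continuous.
    intro v L hLW hL
    have hcb : ContinuousOn (fun y => b (e.symm y) * ‖coordVec p y v‖) L := by
      refine ContinuousOn.mul (hb.comp_continuousOn
        (e.continuousOn_symm.mono (hLW.trans inter_subset_left))) ?_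
      simp only [norm_eq_sqrt_real_inner]
      exact Real.continuous_sqrt.comp_continuousOn
        ((continuousOn_inner_coordVec p v v).mono (hLW.trans inter_subset_left))
    obtain ⟨B, hB⟩ := hL.exists_bound_of_continuousOn hcb
    refine ⟨B, (ae_restrict_iff' hL.measurableSet).2 ?_⟩
    filter_upwards [hae] with y hy hyL
    refine (abs_real_inner_le_norm _ _).trans ?_
    rw [hy (hLW hyL).1 (hLW hyL).2]
    exact (le_abs_self _).trans (hB y hyL)
  have hKc : IsCompact (e '' K) := hK.image_of_continuousOn (e.continuousOn.mono hKp)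
  obtain ⟨F, hF, hFf, hFd, hFB⟩ := exists_mollified_seq hW hKc hKW (f := fun y => f (e.symm y))
    (g := g) (hf.comp_continuousOn (e.continuousOn_symm.mono inter_subset_left))
    (fun v => (hZ p v).2.1) (fun v => (hZ p v).2.2) hgb
  have hFs : ∀ k, ContMDiffOn (𝓡 n) 𝓘(ℝ, ℝ) ∞ (fun x => F k (e x)) e.source := fun k =>
    (hF k).contMDiff.comp_contMDiffOn (contMDiffOn_chart' p)
  have hsum : ∀ k, ∀ y ∈ e.target,
      inner ℝ (Z (e.symm y)) (grad (fun x => F k (e x)) (e.symm y)) =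
        ∑ i, ∑ j, g (EuclideanSpace.single i 1) y * ((gram p y)⁻¹ i j *
          fderiv ℝ (F k) y (EuclideanSpace.single j 1)) := by
    intro k y hy
    have hd : MDifferentiableAt (𝓡 n) 𝓘(ℝ, ℝ) (fun x => F k (e x)) (e.symm y) :=
      ((hFs k).contMDiffAt (e.open_source.mem_nhds (e.map_target hy))).mdifferentiableAt (by simp)
    have heq : (fun z => F k (e (e.symm z))) =ᶠ[𝓝 y] F k := by
      filter_upwards [e.open_target.mem_nhds hy] with z hz
      rw [e.right_inv hz]
    have := inner_grad_eq_sum hy hd (Z (e.symm y))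
    rw [heq.fderiv_eq] at this
    exact this
  have himg : ∀ y ∈ e.target, e.symm y ∈ K → y ∈ e '' K := fun y hy hyK =>
    ⟨e.symm y, hyK, e.right_inv hy⟩
  refine ⟨fun k x => F k (e x), hFs, fun k x hx => ?_, ?_, ?_⟩
  · have := hFf k (e x) (mem_image_of_mem e hx)
    rwa [e.left_inv (hKp hx)] at this
  · refine Eventually.mono ((ae_chart_iff p (P := fun x => x ∈ K →
        Tendsto (fun k => inner ℝ (Z x) (grad (fun x => F k (e x)) x)) atTop (𝓝 (b x ^ 2)))).1
          ?_) fun x hx hxK => hx (hKp hxK) hxK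
    · have h2 : ∀ᵐ y : 𝔼 n, ∀ i : Fin n, y ∈ e '' K → Tendsto (fun k => fderiv ℝ (F k) y
          (EuclideanSpace.single i 1)) atTop (𝓝 (g (EuclideanSpace.single i 1) y)) :=
        ae_all_iff.2 fun i => hFd _
      filter_upwards [h2, hae] with y hy hyb hyt hyK
      have hyi := himg y hyt hyK
      -- The limit is identified by writing `‖Z‖²` with the inverse Gram matrix, the same form as
      -- `⟨Z, ∇F k⟩`.
      have h3 : b (e.symm y) ^ 2 = ∑ i, ∑ j, g (EuclideanSpace.single i 1) y * ((gram p y)⁻¹ i j *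
          g (EuclideanSpace.single j 1) y) := by
        rw [← hyb hyt (hKU hyK), ← real_inner_self_eq_norm_sq]
        exact inner_eq_sum_gram_inv hyt _ _
      change Tendsto (fun k => inner ℝ (Z (e.symm y)) (grad (fun x => F k (e x)) (e.symm y))) atTop
        (𝓝 (b (e.symm y) ^ 2))
      rw [h3, funext fun k => hsum k y hyt]
      refine tendsto_finsetSum _ fun i _ => tendsto_finsetSum _ fun j _ => ?_
      exact ((hy j hyi).const_mul _).const_mul _
  · choose B hB using hFB
    choose A hA using fun v => hgb v _ hKW hKc
    have hG : ∀ i j, ∃ C, ∀ y ∈ e '' K, ‖(gram p y)⁻¹ i j‖ ≤ C := fun i j =>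
      hKc.exists_bound_of_continuousOn
        ((continuousOn_gram_inv p i j).mono (hKW.trans inter_subset_left))
    choose C hC using hG
    refine ⟨∑ i, ∑ j, A (EuclideanSpace.single i 1) * (C i j * B (EuclideanSpace.single j 1)),
      fun k => ?_⟩
    refine Eventually.mono ((ae_chart_iff p (P := fun x => x ∈ K →
        |inner ℝ (Z x) (grad (fun x => F k (e x)) x)| ≤
          ∑ i, ∑ j, A (EuclideanSpace.single i 1) * (C i j * B (EuclideanSpace.single j 1)))).1
          ?_) fun x hx hxK => hx (hKp hxK) hxK
    · have h2 : ∀ᵐ y : 𝔼 n, ∀ i : Fin n, y ∈ e '' K →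
          |g (EuclideanSpace.single i 1) y| ≤ A (EuclideanSpace.single i 1) :=
        ae_all_iff.2 fun i => (ae_restrict_iff' hKc.measurableSet).1 (hA _)
      filter_upwards [h2] with y hy hyt hyK
      have hyi := himg y hyt hyK
      change |inner ℝ (Z (e.symm y)) (grad (fun x => F k (e x)) (e.symm y))| ≤ _
      rw [hsum k y hyt]
      refine (Finset.abs_sum_le_sum_abs _ _).trans (Finset.sum_le_sum fun i _ => ?_)
      refine (Finset.abs_sum_le_sum_abs _ _).trans (Finset.sum_le_sum fun j _ => ?_)
      rw [abs_mul, abs_mul]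
      have hCi := hC i j y hyi
      rw [Real.norm_eq_abs] at hCi
      have hBj := hB (EuclideanSpace.single j 1) k y hyi
      exact mul_le_mul (hy i hyi) (mul_le_mul hCi hBj (abs_nonneg _) ((abs_nonneg _).trans hCi))
        (by positivity) ((abs_nonneg _).trans (hy i hyi))

end Local

/-! ### Testing the distributional inequality with nonsmooth functions of `f`. -/

section Testing

open Filter

variable {n : ℕ} {M : Type*} [TopologicalSpace M] [T2Space M] [SecondCountableTopology M]
  [Nonempty M] [MeasurableSpace M] [BorelSpace M] [ChartedSpace (𝔼 n) M] [IsManifold (𝓡 n) ∞ M]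
  [RiemannianBundle (fun x : M => TangentSpace (𝓡 n) x)]
  [IsContMDiffRiemannianBundle (𝓡 n) ∞ (𝔼 n) (fun x : M => TangentSpace (𝓡 n) x)]
  {U : Set M} {f b : M → ℝ} {Z : (x : M) → TangentSpace (𝓡 n) x}

/-- Smooth approximation of `h ∘ f` on a compact subset of a chart, good enough to pass to the limit
in `∫ G (h ∘ f)` and in `∫ ⟨Z, ∇((h ∘ f) ξ)⟩`. -/
lemma exists_smooth_seq_comp (hU : IsOpen U) (hf : Continuous f) (hfU : ∀ x ∈ U, 0 < f x)
    (hZ : IsWeakGradientOn U f Z) (hb : Continuous b)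
    (hZb : ∀ᵐ x ∂(riemVolume n M).restrict U, ‖Z x‖ = b x) {h : ℝ → ℝ}
    (hh : ContDiffOn ℝ ∞ h (Ioi 0)) (hh0 : ∀ r, 0 < r → 0 ≤ h r) (p : M) {K : Set M}
    (hK : IsCompact K) (hKp : K ⊆ (chartAt (𝔼 n) p).source) (hKU : K ⊆ U) :
    ∃ H : ℕ → M → ℝ,
      (∀ k, ∀ x ∈ K, 0 ≤ H k x) ∧
      (∀ k, ∀ ξ : M → ℝ, ContMDiff (𝓡 n) 𝓘(ℝ, ℝ) ∞ ξ → tsupport ξ ⊆ K →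
        ContMDiff (𝓡 n) 𝓘(ℝ, ℝ) ∞ fun x => H k x * ξ x) ∧
      (∀ G : M → ℝ, IntegrableOn G K (riemVolume n M) →
        Tendsto (fun k => ∫ x in K, G x * H k x ∂riemVolume n M) atTop
          (𝓝 (∫ x in K, G x * h (f x) ∂riemVolume n M))) ∧
      ∀ ξ : M → ℝ, ContMDiff (𝓡 n) 𝓘(ℝ, ℝ) ∞ ξ → tsupport ξ ⊆ K →
        Tendsto (fun k => ∫ x in K, inner ℝ (Z x) (grad (fun x => H k x * ξ x) x) ∂riemVolume n M)
          atTop (𝓝 (∫ x in K, (h (f x) * inner ℝ (Z x) (grad ξ x) +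
            ξ x * (deriv h (f x) * b x ^ 2)) ∂riemVolume n M)) := by
  have := isLocallyFiniteMeasure_riemVolume (n := n) (M := M)
  obtain ⟨F, hFs, hFf, hFt, B, hFB⟩ := exists_smooth_seq hU hf hZ hb hZb p hK hKp hKU
  obtain ⟨δ, hδ, hδK⟩ := hK.exists_forall_le' hf.continuousOn (a := 0) (fun x hx => hfU x (hKU hx))
  obtain ⟨R, hR⟩ := hK.exists_bound_of_continuousOn hf.continuousOn
  -- Dropping the first `k₀` terms keeps the approximations within `δ/2` of `f ≥ δ`. Their values on
  -- `K` then lie in the compact interval `I` of positive reals, where `h` and `h'` are bounded.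
  obtain ⟨k₀, hk₀⟩ := exists_nat_one_div_lt (half_pos hδ)
  have hsmall : ∀ k : ℕ, 1 / (((k + k₀ : ℕ) : ℝ) + 1) ≤ δ / 2 := fun k => by
    refine le_trans ?_ hk₀.le
    apply one_div_le_one_div_of_le (by positivity)
    push_cast
    linarith [(Nat.cast_nonneg k : (0 : ℝ) ≤ k)]
  set I := Icc (δ / 2) (R + δ / 2)
  have hI0 : I ⊆ Ioi 0 := fun r hr => lt_of_lt_of_le (half_pos hδ) hr.1
  have hFI : ∀ k, ∀ x ∈ K, F (k + k₀) x ∈ I := by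
    intro k x hx
    have h1 := abs_le.1 ((hFf (k + k₀) x hx).trans (hsmall k))
    have h2 := hδK x hx
    have h3 := (le_abs_self _).trans (hR x hx)
    exact ⟨by linarith [h1.1], by linarith [h1.2]⟩
  have hd : ContinuousOn (deriv h) (Ioi 0) := hh.continuousOn_deriv_of_isOpen isOpen_Ioi (by simp)
  obtain ⟨B₀, hB₀⟩ := (isCompact_Icc : IsCompact I).exists_bound_of_continuousOn
    (hh.continuousOn.mono hI0)
  obtain ⟨B₁, hB₁⟩ := (isCompact_Icc : IsCompact I).exists_bound_of_continuousOn (hd.mono hI0)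
  have hF0 : ∀ k, ∀ x ∈ K, F (k + k₀) x ∈ Ioi (0 : ℝ) := fun k x hx => hI0 (hFI k x hx)
  have hFat : ∀ k, ∀ x ∈ K, ContMDiffAt (𝓡 n) 𝓘(ℝ, ℝ) ∞ (F k) x := fun k x hx =>
    (hFs k).contMDiffAt ((chartAt (𝔼 n) p).open_source.mem_nhds (hKp hx))
  have hHat : ∀ k, ∀ x ∈ K, ContMDiffAt (𝓡 n) 𝓘(ℝ, ℝ) ∞ (fun x => h (F (k + k₀) x)) x :=
    fun k x hx => ((hh.contDiffAt (Ioi_mem_nhds (hF0 k x hx))).contMDiffAt).comp x (hFat _ x hx)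
  have hsmooth : ∀ k, ∀ ξ : M → ℝ, ContMDiff (𝓡 n) 𝓘(ℝ, ℝ) ∞ ξ → tsupport ξ ⊆ K →
        ContMDiff (𝓡 n) 𝓘(ℝ, ℝ) ∞ fun x => h (F (k + k₀) x) * ξ x := by
    intro k ξ hξ hξK
    -- The approximation of `h ∘ f` is known to be smooth only at points of `K`, which suffices
    -- because `ξ` is supported there.
    refine contMDiff_of_tsupport fun x hx => ?_
    exact (hHat k x (hξK (tsupport_mul_subset_right hx))).mul hξ.contMDiffAt
  have hlim : ∀ x ∈ K, Tendsto (fun k => F (k + k₀) x) atTop (𝓝 (f x)) := by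
    intro x hx
    have h1 : Tendsto (fun k => F k x) atTop (𝓝 (f x)) := by
      rw [tendsto_iff_norm_sub_tendsto_zero]
      exact squeeze_zero (fun _ => norm_nonneg _) (fun k => hFf k x hx)
        tendsto_one_div_add_atTop_nhds_zero_nat
    exact (tendsto_add_atTop_iff_nat k₀).2 h1
  have hlimh : ∀ x ∈ K, Tendsto (fun k => h (F (k + k₀) x)) atTop (𝓝 (h (f x))) := fun x hx =>
    ((hh.continuousOn.continuousAt (Ioi_mem_nhds (hfU x (hKU hx)))).tendsto).comp (hlim x hx)
  have hlimd : ∀ x ∈ K, Tendsto (fun k => deriv h (F (k + k₀) x)) atTop (𝓝 (deriv h (f x))) :=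
    fun x hx =>
      ((hd.continuousAt (Ioi_mem_nhds (hfU x (hKU hx)))).tendsto).comp (hlim x hx)
  refine ⟨fun k x => h (F (k + k₀) x), fun k x hx => hh0 _ (hF0 k x hx), hsmooth,
    fun G hG => ?_, fun ξ hξ hξK => ?_⟩
  · refine tendsto_integral_of_dominated_convergence (fun x => |G x| * B₀) (fun k => ?_)
      (hG.abs.mul_const B₀) (fun k => ?_) ?_
    · exact hG.aestronglyMeasurable.mul (ContinuousOn.aestronglyMeasurable
        (fun x hx => (hHat k x hx).continuousAt.continuousWithinAt) hK.measurableSet)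
    · filter_upwards [ae_restrict_mem hK.measurableSet] with x hx
      rw [norm_mul]
      exact mul_le_mul_of_nonneg_left (hB₀ _ (hFI k x hx)) (norm_nonneg _)
    · filter_upwards [ae_restrict_mem hK.measurableSet] with x hx
      exact (hlimh x hx).const_mul _
  · have hid : ∀ k, ∀ x ∈ K, inner ℝ (Z x) (grad (fun x => h (F (k + k₀) x) * ξ x) x) =
        h (F (k + k₀) x) * inner ℝ (Z x) (grad ξ x) +
          ξ x * (deriv h (F (k + k₀) x) * inner ℝ (Z x) (grad (F (k + k₀)) x)) := by
      intro k x hx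
      rw [inner_grad_mul ((hHat k x hx).mdifferentiableAt (by simp))
        (hξ.mdifferentiableAt (by simp)), inner_grad_comp ((hFat _ x hx).mdifferentiableAt (by simp))
        (((hh.contDiffAt (Ioi_mem_nhds (hF0 k x hx))).differentiableAt (by simp)).hasDerivAt)]
    have hint := integrableOn_mul_inner_grad hU hZ hb hZb hξ hK hKU
      (continuousOn_const (c := (1 : ℝ)))
    simp only [one_mul] at hint
    refine tendsto_integral_of_dominated_convergence
      (fun x => |inner ℝ (Z x) (grad ξ x)| * B₀ + |ξ x| * (B₁ * B)) (fun k => ?_)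
      ((hint.abs.mul_const B₀).add
        ((hξ.continuous.abs.continuousOn.integrableOn_compact hK).mul_const _)) (fun k => ?_) ?_
    · exact (aestronglyMeasurable_inner_grad hU hZ (hsmooth k ξ hξ hξK)).mono_measure
        (Measure.restrict_mono hKU le_rfl)
    · filter_upwards [ae_restrict_mem hK.measurableSet, ae_restrict_of_ae (hFB (k + k₀))]
        with x hx hxB
      have h0 := hB₀ _ (hFI k x hx)
      have h1 := hB₁ _ (hFI k x hx)
      rw [Real.norm_eq_abs] at h0 h1
      rw [hid k x hx, Real.norm_eq_abs]
      refine (abs_add_le _ _).trans (add_le_add ?_ ?_)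
      · rw [abs_mul, mul_comm]
        exact mul_le_mul_of_nonneg_left h0 (abs_nonneg _)
      · rw [abs_mul, abs_mul]
        exact mul_le_mul_of_nonneg_left (mul_le_mul h1 (hxB hx) (abs_nonneg _)
          ((abs_nonneg _).trans h1)) (abs_nonneg _)
    · filter_upwards [ae_restrict_mem hK.measurableSet, ae_restrict_of_ae hFt] with x hx hxt
      have h1 := ((hlimh x hx).mul_const (inner ℝ (Z x) (grad ξ x))).add
        (((hlimd x hx).mul ((tendsto_add_atTop_iff_nat k₀).2 (hxt hx))).const_mul (ξ x))
      exact h1.congr fun k => (hid k x hx).symm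

lemma integrable_of_continuousOn_compact [IsLocallyFiniteMeasure (riemVolume n M)] {K : Set M}
    {k : M → ℝ} (hK : IsCompact K) (hk : ContinuousOn k K) (h0 : ∀ x ∉ K, k x = 0) :
    Integrable k (riemVolume n M) :=
  (integrableOn_iff_integrable_of_support_subset (fun x hx => by
    by_contra h
    exact hx (h0 x h))).1 (hk.integrableOn_compact hK)

lemma IsTestFunction.mul {ζ ξ : M → ℝ} (hζ : IsTestFunction n U ζ)
    (hξ : ContMDiff (𝓡 n) 𝓘(ℝ, ℝ) ∞ ξ) : IsTestFunction n U fun x => ξ x * ζ x :=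
  ⟨hξ.mul hζ.1, hζ.2.1.mul_left, (tsupport_mul_subset_right).trans hζ.2.2⟩

variable {a H₀ w : M → ℝ} {c₁ : ℝ} {h : ℝ → ℝ}

/-- The integrand obtained by testing `-⟨Z, ∇(a ψ)⟩ + c₁ a ⟨∇w, Z⟩ ψ ≥ H₀ ψ` with
`ψ = (h ∘ f) ζ`. -/
def testIntegrand (f b a H₀ w : M → ℝ) (c₁ : ℝ) (h : ℝ → ℝ) (Z : (x : M) → TangentSpace (𝓡 n) x)
    (ζ : M → ℝ) (x : M) : ℝ :=
  H₀ x * ζ x * h (f x) + (h (f x) * inner ℝ (Z x) (grad (fun x => a x * ζ x) x) +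
    a x * ζ x * (deriv h (f x) * b x ^ 2)) -
    a x * (c₁ * inner ℝ (grad w x) (Z x)) * ζ x * h (f x)

lemma testIntegrand_of_notMem_tsupport {ζ : M → ℝ} {x : M} (hx : x ∉ tsupport ζ) :
    testIntegrand f b a H₀ w c₁ h Z ζ x = 0 := by
  have h1 : x ∉ tsupport fun x => a x * ζ x := fun hx' => hx (tsupport_mul_subset_right hx')
  simp [testIntegrand, inner_grad_of_notMem_tsupport h1, image_eq_zero_of_notMem_tsupport hx]

/-- Linearity in the cutoff is what allows a partition of unity to be used. -/
lemma testIntegrand_add {ζ ξ : M → ℝ} (ha : MDifferentiable (𝓡 n) 𝓘(ℝ, ℝ) a)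
    (hζ : MDifferentiable (𝓡 n) 𝓘(ℝ, ℝ) ζ) (hξ : MDifferentiable (𝓡 n) 𝓘(ℝ, ℝ) ξ) (x : M) :
    testIntegrand f b a H₀ w c₁ h Z (fun x => ζ x + ξ x) x =
      testIntegrand f b a H₀ w c₁ h Z ζ x + testIntegrand f b a H₀ w c₁ h Z ξ x := by
  simp only [testIntegrand]
  rw [inner_grad_mul (ha x) (hζ x), inner_grad_mul (ha x) (hξ x),
    inner_grad_mul (g := fun x => ζ x + ξ x) (ha x) ((hζ x).add (hξ x)), inner_grad_add (hζ x) (hξ x)]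
  ring

lemma testIntegrand_sum {ι : Type*} {ζ : ι → M → ℝ} (ha : MDifferentiable (𝓡 n) 𝓘(ℝ, ℝ) a)
    (s : Finset ι) (hζ : ∀ i, MDifferentiable (𝓡 n) 𝓘(ℝ, ℝ) (ζ i)) :
    testIntegrand f b a H₀ w c₁ h Z (fun x => ∑ i ∈ s, ζ i x) =
      fun x => ∑ i ∈ s, testIntegrand f b a H₀ w c₁ h Z (ζ i) x := by
  classical
  have hd : ∀ s : Finset ι, MDifferentiable (𝓡 n) 𝓘(ℝ, ℝ) fun x => ∑ i ∈ s, ζ i x := by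
    intro s
    induction s using Finset.induction_on with
    | empty => simpa using mdifferentiable_const
    | insert i s hi ih =>
      simp only [Finset.sum_insert hi]
      exact (hζ i).add ih
  funext x
  induction s using Finset.induction_on with
  | empty =>
    simp only [Finset.sum_empty]
    refine testIntegrand_of_notMem_tsupport ?_
    simp [tsupport_eq_empty_iff.2 (rfl : (fun _ : M => (0 : ℝ)) = 0)]
  | insert i s hi ih =>
    simp only [Finset.sum_insert hi]
    rw [testIntegrand_add ha (hζ i) (hd s), ih]

section

variable (hU : IsOpen U) (hf : Continuous f) (hfU : ∀ x ∈ U, 0 < f x)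
    (hZ : IsWeakGradientOn U f Z) (hb : Continuous b)
    (hZb : ∀ᵐ x ∂(riemVolume n M).restrict U, ‖Z x‖ = b x)
    (hh : ContDiffOn ℝ ∞ h (Ioi 0)) (hh0 : ∀ r, 0 < r → 0 ≤ h r)
    (ha : ContMDiff (𝓡 n) 𝓘(ℝ, ℝ) ∞ a) (hH₀ : ContinuousOn H₀ U)
    (hw : ContMDiff (𝓡 n) 𝓘(ℝ, ℝ) ∞ w)

include hU hZ hb hZb ha hw hH₀ hf hfU hh

/-- On the compact support, `f` is positive, so `h(f)` and `h'(f)` are continuous, while `‖Z‖`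
agrees a.e. with the continuous function `b`. -/
lemma integrableOn_testIntegrand_parts {ζ : M → ℝ} (hζ : IsTestFunction n U ζ) :
    IntegrableOn (fun x => H₀ x * ζ x) (tsupport ζ) (riemVolume n M) ∧
    IntegrableOn (fun x => a x * (c₁ * inner ℝ (grad w x) (Z x)) * ζ x) (tsupport ζ)
      (riemVolume n M) ∧
    IntegrableOn (fun x => H₀ x * ζ x * h (f x)) (tsupport ζ) (riemVolume n M) ∧
    IntegrableOn (fun x => h (f x) * inner ℝ (Z x) (grad (fun x => a x * ζ x) x) +
      a x * ζ x * (deriv h (f x) * b x ^ 2)) (tsupport ζ) (riemVolume n M) ∧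
    IntegrableOn (fun x => a x * (c₁ * inner ℝ (grad w x) (Z x)) * ζ x * h (f x)) (tsupport ζ)
      (riemVolume n M) := by
  have := isLocallyFiniteMeasure_riemVolume (n := n) (M := M)
  obtain ⟨hζs, hζc, hζU⟩ := hζ
  have hK : IsCompact (tsupport ζ) := hζc
  have hmaps : MapsTo f (tsupport ζ) (Ioi 0) := fun x hx => hfU x (hζU hx)
  have hhf : ContinuousOn (fun x => h (f x)) (tsupport ζ) :=
    hh.continuousOn.comp hf.continuousOn hmaps
  have hdf : ContinuousOn (fun x => deriv h (f x)) (tsupport ζ) :=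
    (hh.continuousOn_deriv_of_isOpen isOpen_Ioi (by simp)).comp hf.continuousOn hmaps
  have hHζ : ContinuousOn (fun x => H₀ x * ζ x) (tsupport ζ) :=
    (hH₀.mono hζU).mul hζs.continuous.continuousOn
  have hac := ha.continuous.continuousOn (s := tsupport ζ)
  have hζcont := hζs.continuous.continuousOn (s := tsupport ζ)
  refine ⟨hHζ.integrableOn_compact hK, ?_, (hHζ.mul hhf).integrableOn_compact hK, ?_, ?_⟩
  · refine (integrableOn_mul_inner_grad hU hZ hb hZb hw hK hζU
      ((hac.mul continuousOn_const).mul hζcont (g := ζ) (f := fun x => a x * c₁))).congr_fun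
      (fun x _ => ?_) hK.measurableSet
    simp only [Pi.mul_apply]
    rw [real_inner_comm]
    ring
  · exact (integrableOn_mul_inner_grad hU hZ hb hZb (ha.mul hζs) hK hζU hhf).add
      (((hac.mul hζcont).mul (hdf.mul (hb.continuousOn.pow 2))).integrableOn_compact hK)
  · refine (integrableOn_mul_inner_grad hU hZ hb hZb hw hK hζU
      (((hac.mul continuousOn_const).mul hζcont (g := ζ) (f := fun x => a x * c₁)).mul hhf)).congr_fun
      (fun x _ => ?_) hK.measurableSet
    simp only [Pi.mul_apply]
    rw [real_inner_comm]
    ring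

lemma integrable_testIntegrand {ζ : M → ℝ} (hζ : IsTestFunction n U ζ) :
    Integrable (testIntegrand f b a H₀ w c₁ h Z ζ) (riemVolume n M) := by
  obtain ⟨-, -, h1, h2, h3⟩ :=
    integrableOn_testIntegrand_parts (c₁ := c₁) hU hf hfU hZ hb hZb hh ha hH₀ hw hζ
  refine (integrableOn_iff_integrable_of_support_subset fun x hx => ?_).1 ((h1.add h2).sub h3)
  by_contra hxK
  exact hx (testIntegrand_of_notMem_tsupport hxK)

include hh0

/-- Test with `H k * ζ`, where `H k` approximates `h ∘ f` smoothly, and let `k` tend to infinity. -/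
lemma integral_testIntegrand_nonpos_of_chart
    (hlap : ∀ ψ : M → ℝ, IsTestFunction n U ψ → (∀ x, 0 ≤ ψ x) →
      ∫ x, H₀ x * ψ x ∂riemVolume n M ≤
        - ∫ x, inner ℝ (Z x) (grad (fun x => a x * ψ x) x) ∂riemVolume n M +
        ∫ x, a x * (c₁ * inner ℝ (grad w x) (Z x)) * ψ x ∂riemVolume n M)
    {ζ : M → ℝ} (hζ : IsTestFunction n U ζ) (hζ0 : ∀ x, 0 ≤ ζ x) {p : M}
    (hζp : tsupport ζ ⊆ (chartAt (𝔼 n) p).source) :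
    ∫ x, testIntegrand f b a H₀ w c₁ h Z ζ x ∂riemVolume n M ≤ 0 := by
  obtain ⟨i1, i2, j1, j2, j3⟩ :=
    integrableOn_testIntegrand_parts (c₁ := c₁) hU hf hfU hZ hb hZb hh ha hH₀ hw hζ
  obtain ⟨hζs, hζc, hζU⟩ := hζ
  obtain ⟨H, hH0, hHs, hH1, hH2⟩ :=
    exists_smooth_seq_comp hU hf hfU hZ hb hZb hh hh0 p hζc hζp hζU
  have haζ : tsupport (fun x => a x * ζ x) ⊆ tsupport ζ := tsupport_mul_subset_right
  have t1 := hH1 _ i1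
  have t2 := hH1 _ i2
  -- The cutoff is `a ζ` here because the hypothesis contains the gradient of `a ψ`.
  have t3 := hH2 (fun x => a x * ζ x) (ha.mul hζs) haζ
  have hle := le_of_tendsto_of_tendsto' t1 (t3.neg.add t2) (fun k => by
    have hz : ∀ x ∉ tsupport ζ, ζ x = 0 := fun x hx => image_eq_zero_of_notMem_tsupport hx
    have hψ : IsTestFunction n U fun x => H k x * ζ x :=
      ⟨hHs k ζ hζs subset_rfl, hζc.mul_left, tsupport_mul_subset_right.trans hζU⟩
    have h1 := hlap _ hψ (fun x => by
      by_cases hx : x ∈ tsupport ζ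
      · exact mul_nonneg (hH0 k x hx) (hζ0 x)
      · rw [hz x hx, mul_zero])
    rw [setIntegral_eq_integral_of_forall_compl_eq_zero (f := fun x => H₀ x * ζ x * H k x)
        fun x hx => by rw [hz x hx]; ring,
      setIntegral_eq_integral_of_forall_compl_eq_zero
        (f := fun x => a x * (c₁ * inner ℝ (grad w x) (Z x)) * ζ x * H k x)
        fun x hx => by rw [hz x hx]; ring,
      setIntegral_eq_integral_of_forall_compl_eq_zero
        (f := fun x => inner ℝ (Z x) (grad (fun x => H k x * (a x * ζ x)) x)) fun x hx =>
        inner_grad_of_notMem_tsupport (fun hx' => hx (haζ (tsupport_mul_subset_right hx'))) _]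
    have e1 : (fun x => H₀ x * ζ x * H k x) = fun x => H₀ x * (H k x * ζ x) := by
      funext x
      ring
    have e2 : (fun x => H k x * (a x * ζ x)) = fun x => a x * (H k x * ζ x) := by
      funext x
      ring
    have e3 : (fun x => a x * (c₁ * inner ℝ (grad w x) (Z x)) * ζ x * H k x) =
        fun x => a x * (c₁ * inner ℝ (grad w x) (Z x)) * (H k x * ζ x) := by
      funext x
      ring
    rw [e1, e2, e3]
    exact h1)
  rw [← setIntegral_eq_integral_of_forall_compl_eq_zero (s := tsupport ζ)
    fun x hx => testIntegrand_of_notMem_tsupport hx]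
  have e1 := integral_sub (j1.add j2) j3
  have e2 := integral_add j1 j2
  simp only [Pi.add_apply] at e1
  unfold testIntegrand
  rw [e1, e2]
  linarith

/-- Split `ζ` by a partition of unity subordinate to chart domains; only finitely many pieces meet
its compact support. -/
lemma integral_testIntegrand_nonpos
    (hlap : ∀ ψ : M → ℝ, IsTestFunction n U ψ → (∀ x, 0 ≤ ψ x) →
      ∫ x, H₀ x * ψ x ∂riemVolume n M ≤
        - ∫ x, inner ℝ (Z x) (grad (fun x => a x * ψ x) x) ∂riemVolume n M +
        ∫ x, a x * (c₁ * inner ℝ (grad w x) (Z x)) * ψ x ∂riemVolume n M)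
    {ζ : M → ℝ} (hζ : IsTestFunction n U ζ) (hζ0 : ∀ x, 0 ≤ ζ x) :
    ∫ x, testIntegrand f b a H₀ w c₁ h Z ζ x ∂riemVolume n M ≤ 0 := by
  have : LocallyCompactSpace M := ChartedSpace.locallyCompactSpace (𝔼 n) M
  have : SigmaCompactSpace M := sigmaCompactSpace_of_locallyCompact_secondCountable
  obtain ⟨χ, hχ⟩ := SmoothPartitionOfUnity.exists_isSubordinate_chartAt_source (𝓡 n) M
  have hfin := χ.locallyFinite.finite_nonempty_inter_compact hζ.2.1
  set s := hfin.toFinset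
  have hχζ : ∀ i, IsTestFunction n U fun x => χ i x * ζ x := fun i => hζ.mul (χ i).contMDiff
  have hsum : ζ = fun x => ∑ i ∈ s, χ i x * ζ x := by
    funext x
    rw [← Finset.sum_mul]
    by_cases hx : x ∈ tsupport ζ
    · have h1 := χ.sum_eq_one (mem_univ x)
      rw [finsum_eq_sum_of_support_subset (s := s) _ fun i hi => by
        simp only [s, Finite.coe_toFinset]
        exact ⟨x, hi, hx⟩] at h1
      rw [h1, one_mul]
    · rw [image_eq_zero_of_notMem_tsupport hx, mul_zero]
  have hI := fun i => integrable_testIntegrand (c₁ := c₁) hU hf hfU hZ hb hZb hh ha hH₀ hw (hχζ i)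
  rw [hsum, testIntegrand_sum (ha.mdifferentiable (by simp)) s
    fun i => (hχζ i).1.mdifferentiable (by simp), integral_finsetSum _ fun i _ => hI i]
  refine Finset.sum_nonpos fun i _ => ?_
  exact integral_testIntegrand_nonpos_of_chart hU hf hfU hZ hb hZb hh hh0 ha hH₀ hw hlap (hχζ i)
    (fun x => mul_nonneg (χ.nonneg i x) (hζ0 x))
    ((tsupport_mul_subset_left).trans (hχ i))

end

end Testing

/-! ### The radial weight and the completed square. -/

section HardyWeight

/-- The radial weight `(c + d r^α)^β / r^(2m+1)`. -/
def hardyWeight (m c d α β r : ℝ) : ℝ := (c + d * r ^ α) ^ β * r ^ (-(2 * m + 1))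

variable {m c d α β r : ℝ}

lemma hardyWeight_base_pos (hc : 0 < c) (hd : 0 < d) (hr : 0 < r) : 0 < c + d * r ^ α :=
  add_pos hc (mul_pos hd (Real.rpow_pos_of_pos hr α))

lemma hardyWeight_pos (hc : 0 < c) (hd : 0 < d) (hr : 0 < r) : 0 < hardyWeight m c d α β r :=
  mul_pos (Real.rpow_pos_of_pos (hardyWeight_base_pos hc hd hr) _) (Real.rpow_pos_of_pos hr _)

/-- The exponent of `hardyWeight` lies midway between those of the two weights in the inequality, so
multiplying and dividing by `r` recovers them. -/
lemma hardyWeight_mul (hr : 0 < r) :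
    hardyWeight m c d α β r * r = (c + d * r ^ α) ^ β / r ^ (2 * m) := by
  rw [hardyWeight, mul_assoc, div_eq_mul_inv, ← Real.rpow_neg hr.le]
  congr 1
  nth_rewrite 2 [← Real.rpow_one r]
  rw [← Real.rpow_add hr]
  congr 1
  ring

lemma hardyWeight_div (hr : 0 < r) :
    hardyWeight m c d α β r / r = (c + d * r ^ α) ^ β / r ^ (2 * m + 2) := by
  rw [hardyWeight, mul_div_assoc, div_eq_mul_inv _ (r ^ (2 * m + 2)), ← Real.rpow_neg hr.le]
  congr 1
  rw [← Real.rpow_sub_one hr.ne']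
  congr 1
  ring

lemma contDiffOn_hardyWeight (hc : 0 < c) (hd : 0 < d) :
    ContDiffOn ℝ ∞ (hardyWeight m c d α β) (Ioi 0) := by
  have hp : ∀ s : ℝ, ContDiffOn ℝ ∞ (fun r : ℝ => r ^ s) (Ioi 0) := fun s =>
    contDiffOn_id.rpow_const_of_ne fun r (hr : 0 < r) => hr.ne'
  exact ((contDiffOn_const.add (contDiffOn_const.mul (hp α))).rpow_const_of_ne
    fun r (hr : 0 < r) => (hardyWeight_base_pos hc hd hr).ne').mul (hp _)

/-- Differentiating `(c + d r^α)^β` contributes a term with the sign of `αβ`, which is dropped; the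
power of `r` gives the bound. -/
lemma le_deriv_hardyWeight (hc : 0 < c) (hd : 0 < d) (hαβ : 0 < α * β) (hr : 0 < r) :
    -(2 * m + 1) * (hardyWeight m c d α β r / r) ≤ deriv (hardyWeight m c d α β) r := by
  have h1 : HasDerivAt (fun r : ℝ => c + d * r ^ α) (d * (α * r ^ (α - 1))) r :=
    ((Real.hasDerivAt_rpow_const (Or.inl hr.ne')).const_mul d).const_add c
  have h2 := h1.rpow_const (p := β) (Or.inl (hardyWeight_base_pos hc hd hr).ne')
  have h3 : HasDerivAt (fun r : ℝ => r ^ (-(2 * m + 1))) _ r :=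
    Real.hasDerivAt_rpow_const (Or.inl hr.ne')
  have h4 : HasDerivAt (hardyWeight m c d α β) _ r := h2.mul h3
  rw [h4.deriv, hardyWeight, Real.rpow_sub_one hr.ne' (-(2 * m + 1))]
  have h5 : 0 ≤ d * (α * r ^ (α - 1)) * β * (c + d * r ^ α) ^ (β - 1) * r ^ (-(2 * m + 1)) := by
    have e : d * (α * r ^ (α - 1)) * β * (c + d * r ^ α) ^ (β - 1) * r ^ (-(2 * m + 1)) =
      (α * β) * (d * r ^ (α - 1) * (c + d * r ^ α) ^ (β - 1) * r ^ (-(2 * m + 1))) := by ring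
    rw [e]
    have := hardyWeight_base_pos (α := α) hc hd hr
    positivity
  have e2 : (c + d * r ^ α) ^ β * (-(2 * m + 1) * (r ^ (-(2 * m + 1)) / r)) =
    -(2 * m + 1) * ((c + d * r ^ α) ^ β * r ^ (-(2 * m + 1)) / r) := by ring
  linarith

/-- Pointwise form of the estimate, by completing the square. -/
lemma sq_mul_sub_le {k h r φ A t w : ℝ} (hk : 0 ≤ k) (hh : 0 ≤ h) (hr : 0 < r) (hw : 0 ≤ w)
    (ht : w * (2 * k * (h / r) * φ ^ 2 - 2 * h * |φ| * A) ≤ t) :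
    k ^ 2 * (h / r * φ ^ 2 * w) - h * r * A ^ 2 * w ≤ k * t := by
  have h1 : 0 ≤ w * (h / r * (k * |φ| - r * A) ^ 2) := by positivity
  have h2 := mul_le_mul_of_nonneg_left ht hk
  have h3 : k * (w * (2 * k * (h / r) * φ ^ 2 - 2 * h * |φ| * A)) -
      (k ^ 2 * (h / r * φ ^ 2 * w) - h * r * A ^ 2 * w) =
      w * (h / r * (k * |φ| - r * A) ^ 2) := by
    rw [← sq_abs φ]
    field_simp
    ring
  linarith

end HardyWeight

/-! ### Gradients of exponential weights. -/

section Exponential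

variable {n : ℕ} {M : Type*} [TopologicalSpace M] [ChartedSpace (𝔼 n) M] [IsManifold (𝓡 n) ∞ M]
  [RiemannianBundle (fun x : M => TangentSpace (𝓡 n) x)] {u φ : M → ℝ}

lemma contMDiff_exp_mul (hu : ContMDiff (𝓡 n) 𝓘(ℝ, ℝ) ∞ u) (s : ℝ) :
    ContMDiff (𝓡 n) 𝓘(ℝ, ℝ) ∞ fun x => Real.exp (s * u x) :=
  (Real.contDiff_exp.comp (contDiff_const.mul contDiff_id)).contMDiff.comp hu

lemma inner_grad_exp_mul_sq (hu : ContMDiff (𝓡 n) 𝓘(ℝ, ℝ) ∞ u) (hφ : ContMDiff (𝓡 n) 𝓘(ℝ, ℝ) ∞ φ)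
    (s : ℝ) (x : M) (v : TangentSpace (𝓡 n) x) :
    inner ℝ v (grad (fun x => Real.exp (s * u x) * φ x ^ 2) x) =
      Real.exp (s * u x) * (2 * φ x * inner ℝ v (grad φ x)) +
        φ x ^ 2 * (s * Real.exp (s * u x) * inner ℝ v (grad u x)) := by
  have hd : HasDerivAt (fun r => Real.exp (s * r)) (s * Real.exp (s * u x)) (u x) := by
    have := ((hasDerivAt_id (u x)).const_mul s).exp
    simpa [mul_comm] using this
  have hs : HasDerivAt (fun r : ℝ => r ^ 2) (2 * φ x) (φ x) := by
    simpa using hasDerivAt_pow 2 (φ x)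
  rw [inner_grad_mul (g := fun x => φ x ^ 2) ((contMDiff_exp_mul hu s).mdifferentiableAt (by simp))
    ((hφ.pow 2).mdifferentiableAt (by simp)),
    inner_grad_comp (hφ.mdifferentiableAt (by simp)) hs,
    inner_grad_comp (hu.mdifferentiableAt (by simp)) hd]

end Exponential

end AffineHardy

end

/-! ### The weighted Hardy inequality. -/

open AffineHardy in
theorem mainTheorem12 (n : ℕ) (M : Type*) [TopologicalSpace M] [T2Space M]
    [SecondCountableTopology M] [Nonempty M] [MeasurableSpace M] [BorelSpace M]
    [ChartedSpace (EuclideanSpace ℝ (Fin n)) M] [IsManifold (𝓡 n) ∞ M]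
    [RiemannianBundle (fun x : M => TangentSpace (𝓡 n) x)]
    [IsContMDiffRiemannianBundle (𝓡 n) ∞ (EuclideanSpace ℝ (Fin n))
      (fun x : M => TangentSpace (𝓡 n) x)]
    (u : M → ℝ) (hu : ContMDiff (𝓡 n) 𝓘(ℝ, ℝ) ∞ u)
    (V : M → ℝ) (hV : ∀ x, V x = Real.exp (u x))
    (lam mu τ : ℝ) (hτ : τ = (n + 1) * lam + mu)
    (C m c d α β : ℝ) (hC : 1 < C) (hm : 0 ≤ C - 2 * m - 1)
    (hc : 0 < c) (hd : 0 < d) (hαβ : 0 < α * β)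
    (ρ : M → ℝ) (hρ : Continuous ρ) (hρ0 : ∀ x, 0 ≤ ρ x)
    (Z : (x : M) → TangentSpace (𝓡 n) x)
    (hZ : AffineHardy.IsWeakGradientOn {x | ρ x ≠ 0} ρ Z)
    (hgrad : ∀ᵐ x ∂(AffineHardy.riemVolume n M).restrict {x | ρ x ≠ 0},
      ‖AffineHardy.affineGrad lam mu u Z x‖ = 1)
    (hlap : AffineHardy.AffineLaplacianGE lam mu u {x | ρ x ≠ 0} Z
      (fun x => C / ρ x * V x ^ (lam - mu)))
    (φ : M → ℝ) (hφ : AffineHardy.IsTestFunction n {x | ρ x ≠ 0} φ) :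
    Integrable (fun x => (c + d * ρ x ^ α) ^ β / ρ x ^ (2 * m) *
      ‖AffineHardy.affineGrad (n := n) lam mu u (AffineHardy.grad (n := n) φ) x‖ ^ 2 * V x ^ (τ + lam - mu))
      (AffineHardy.riemVolume n M) ∧
    Integrable (fun x => (c + d * ρ x ^ α) ^ β / ρ x ^ (2 * m + 2) *
      φ x ^ 2 * V x ^ (τ + lam - mu)) (AffineHardy.riemVolume n M) ∧
    ((C - 2 * m - 1) / 2) ^ 2 *
      ∫ x, (c + d * ρ x ^ α) ^ β / ρ x ^ (2 * m + 2) * φ x ^ 2 * V x ^ (τ + lam - mu)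
        ∂(AffineHardy.riemVolume n M) ≤
      ∫ x, (c + d * ρ x ^ α) ^ β / ρ x ^ (2 * m) *
        ‖AffineHardy.affineGrad (n := n) lam mu u (AffineHardy.grad (n := n) φ) x‖ ^ 2 * V x ^ (τ + lam - mu)
        ∂(AffineHardy.riemVolume n M) := by
  have hlf := isLocallyFiniteMeasure_riemVolume (n := n) (M := M)
  obtain rfl : V = fun x => Real.exp (u x) := funext hV
  set U : Set M := {x | ρ x ≠ 0} with hUdef
  have hU : IsOpen U := isOpen_ne_fun hρ continuous_const
  have hρU : ∀ x ∈ U, 0 < ρ x := fun x hx => lt_of_le_of_ne (hρ0 x) (Ne.symm hx)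
  have hpow : ∀ s x, Real.exp (u x) ^ s = Real.exp (s * u x) := fun s x => by
    rw [← Real.exp_mul, mul_comm]
  set a : M → ℝ := fun x => Real.exp ((mu - lam) * u x) with hadef
  set b : M → ℝ := fun x => Real.exp ((lam - mu) * u x) with hbdef
  have hab : ∀ x, a x * b x = 1 := fun x => by
    rw [hadef, hbdef]
    simp only
    rw [← Real.exp_add, ← Real.exp_zero]
    ring_nf
  have ha := contMDiff_exp_mul hu (mu - lam)
  have hb := contMDiff_exp_mul hu (lam - mu)
  have hnorm : ∀ (Y : (x : M) → TangentSpace (𝓡 n) x) (x : M),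
      ‖affineGrad lam mu u Y x‖ = a x * ‖Y x‖ := by
    intro Y x
    rw [affineGrad, norm_smul, hpow, Real.norm_of_nonneg (Real.exp_pos _).le]
  -- The eikonal condition `|∇^D ρ| = 1` says that `‖Z‖` is the reciprocal of `a`.
  have hZb : ∀ᵐ x ∂(riemVolume n M).restrict U, ‖Z x‖ = b x := by
    filter_upwards [hgrad] with x hx
    rw [hnorm] at hx
    have := hab x
    have hapos : 0 < a x := Real.exp_pos _
    exact mul_left_cancel₀ hapos.ne' (hx.trans this.symm)
  set h := hardyWeight m c d α β
  have hh : ContDiffOn ℝ ∞ h (Ioi 0) := contDiffOn_hardyWeight hc hd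
  have hh0 : ∀ r, 0 < r → 0 ≤ h r := fun r hr => (hardyWeight_pos hc hd hr).le
  obtain ⟨hφs, hφc, hφU⟩ := hφ
  have hK : IsCompact (tsupport φ) := hφc
  have hhφ : ContinuousOn (fun x => h (ρ x)) (tsupport φ) :=
    hh.continuousOn.comp hρ.continuousOn fun x hx => hρU x (hφU hx)
  have hρφ : ∀ x ∈ tsupport φ, ρ x ≠ 0 := fun x hx => (hρU x (hφU hx)).ne'
  have hw : Continuous fun x => Real.exp ((τ + lam - mu) * u x) :=
    (contMDiff_exp_mul hu _).continuous
  have hφ0 : ∀ x ∉ tsupport φ, φ x = 0 := fun x hx => image_eq_zero_of_notMem_tsupport hx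
  have hg0 : ∀ x ∉ tsupport φ, ‖grad (n := n) φ x‖ = 0 := fun x hx => by
    rw [norm_eq_zero, ← inner_self_eq_zero (𝕜 := ℝ)]
    exact inner_grad_of_notMem_tsupport hx _
  have hJ : (fun x => (c + d * ρ x ^ α) ^ β / ρ x ^ (2 * m) *
      ‖affineGrad (n := n) lam mu u (grad (n := n) φ) x‖ ^ 2 * Real.exp (u x) ^ (τ + lam - mu)) =
      fun x => h (ρ x) * ρ x * (a x * ‖grad (n := n) φ x‖) ^ 2 *
        Real.exp ((τ + lam - mu) * u x) := by
    funext x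
    rw [hnorm, hpow]
    -- The power identities need `ρ > 0`, guaranteed on the support of `φ`; elsewhere both sides
    -- vanish.
    by_cases hx : x ∈ tsupport φ
    · rw [hardyWeight_mul (hρU x (hφU hx))]
    · rw [hg0 x hx]
      ring
  have hI : (fun x => (c + d * ρ x ^ α) ^ β / ρ x ^ (2 * m + 2) * φ x ^ 2 *
      Real.exp (u x) ^ (τ + lam - mu)) =
      fun x => h (ρ x) / ρ x * φ x ^ 2 * Real.exp ((τ + lam - mu) * u x) := by
    funext x
    rw [hpow]
    by_cases hx : x ∈ tsupport φ
    · rw [hardyWeight_div (hρU x (hφU hx))]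
    · rw [hφ0 x hx]
      ring
  rw [hJ, hI]
  have iJ : Integrable (fun x => h (ρ x) * ρ x * (a x * ‖grad (n := n) φ x‖) ^ 2 *
      Real.exp ((τ + lam - mu) * u x)) (riemVolume n M) := by
    refine integrable_of_continuousOn_compact hK ?_ fun x hx => by rw [hg0 x hx]; ring
    exact ((hhφ.mul hρ.continuousOn).mul
      ((ha.continuous.mul (continuous_norm_grad hφs)).pow 2).continuousOn).mul hw.continuousOn
  have iI : Integrable (fun x => h (ρ x) / ρ x * φ x ^ 2 *
      Real.exp ((τ + lam - mu) * u x)) (riemVolume n M) := by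
    refine integrable_of_continuousOn_compact hK ?_ fun x hx => by rw [hφ0 x hx]; ring
    exact ((hhφ.div hρ.continuousOn hρφ).mul (hφs.continuous.pow 2).continuousOn).mul
      hw.continuousOn
  refine ⟨iJ, iI, ?_⟩
  set k := (C - 2 * m - 1) / 2 with hk
  have hk0 : 0 ≤ k := by linarith
  set c₁ := 2 * mu + n * lam with hc₁
  have hζs : ContMDiff (𝓡 n) 𝓘(ℝ, ℝ) ∞ fun x => Real.exp (τ * u x) * φ x ^ 2 :=
    (contMDiff_exp_mul hu τ).mul (hφs.pow 2)
  have hζsub : tsupport (fun x => Real.exp (τ * u x) * φ x ^ 2) ⊆ tsupport φ :=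
    closure_mono fun x hx hx0 => hx (by simp [hx0])
  have hζ : IsTestFunction n U fun x => Real.exp (τ * u x) * φ x ^ 2 :=
    ⟨hζs, hK.of_isClosed_subset (isClosed_tsupport _) hζsub, hζsub.trans hφU⟩
  have hH₀ : ContinuousOn (fun x => C / ρ x * b x) U :=
    (continuousOn_const.div hρ.continuousOn fun x hx => hx).mul hb.continuous.continuousOn
  have hlap' : ∀ ψ : M → ℝ, IsTestFunction n U ψ → (∀ x, 0 ≤ ψ x) →
      ∫ x, C / ρ x * b x * ψ x ∂riemVolume n M ≤
        - ∫ x, inner ℝ (Z x) (grad (fun x => a x * ψ x) x) ∂riemVolume n M +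
        ∫ x, a x * (c₁ * inner ℝ (grad u x) (Z x)) * ψ x ∂riemVolume n M := by
    intro ψ hψ hψ0
    have := hlap ψ hψ hψ0
    simp only [affineLaplacian, laplacian, hpow] at this
    exact this
  have hneg := integral_testIntegrand_nonpos hU hρ hρU hZ hb.continuous hZb hh hh0 ha hH₀ hu hlap'
    hζ (fun x => by positivity)
  have iT := integrable_testIntegrand (c₁ := c₁) hU hρ hρU hZ hb.continuous hZb hh ha hH₀ hu hζ
  have hle : ∫ x, (k ^ 2 * (h (ρ x) / ρ x * φ x ^ 2 * Real.exp ((τ + lam - mu) * u x)) -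
      h (ρ x) * ρ x * (a x * ‖grad (n := n) φ x‖) ^ 2 * Real.exp ((τ + lam - mu) * u x))
        ∂riemVolume n M ≤
      ∫ x, k * testIntegrand ρ b a (fun x => C / ρ x * b x) u c₁ h Z
        (fun x => Real.exp (τ * u x) * φ x ^ 2) x ∂riemVolume n M := by
    refine integral_mono_ae ((iI.const_mul _).sub iJ) (iT.const_mul _) ?_
    filter_upwards [(ae_restrict_iff' hU.measurableSet).1 hZb] with x hxb
    by_cases hx : x ∈ tsupport φ
    · have hr := hρU x (hφU hx)
      refine sq_mul_sub_le hk0 (hh0 _ hr) hr (Real.exp_pos _).le ?_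
      have hZx := hxb (hφU hx)
      -- The definition of `τ` enters here: `(μ-λ) + τ` is the drift coefficient `c₁`.
      have e1 : (fun x => a x * (Real.exp (τ * u x) * φ x ^ 2)) =
          fun x => Real.exp (c₁ * u x) * φ x ^ 2 := by
        funext x
        rw [hadef, ← mul_assoc, ← Real.exp_add, hc₁, hτ]
        ring_nf
      set W := Real.exp ((τ + lam - mu) * u x) with hW
      have hWpos : 0 < W := Real.exp_pos _
      have e2 : Real.exp (τ * u x) * b x = W := by
        rw [hbdef, hW, ← Real.exp_add]
        ring_nf
      have e3 : Real.exp (c₁ * u x) = W * a x ^ 2 := by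
        rw [hadef, hW, ← Real.exp_nat_mul, ← Real.exp_add, hc₁, hτ]
        push_cast
        ring_nf
      have e4 : a x * Real.exp (τ * u x) = W * a x ^ 2 := by
        rw [← e2]
        linear_combination (-(a x * Real.exp (τ * u x))) * hab x
      have hcs : -(b x * ‖grad (n := n) φ x‖ * |φ x|) ≤ φ x * inner ℝ (Z x) (grad φ x) := by
        have h1 := abs_real_inner_le_norm (Z x) (grad φ x)
        rw [hZx] at h1
        have h2 := mul_le_mul_of_nonneg_left h1 (abs_nonneg (φ x))
        rw [← abs_mul] at h2
        linarith [neg_abs_le (φ x * inner ℝ (Z x) (grad φ x))]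
      have hder : -(2 * m + 1) * (h (ρ x) / ρ x) ≤ deriv h (ρ x) :=
        le_deriv_hardyWeight hc hd hαβ hr
      have e5 : testIntegrand ρ b a (fun x => C / ρ x * b x) u c₁ h Z
          (fun x => Real.exp (τ * u x) * φ x ^ 2) x =
          W * (C * (h (ρ x) / ρ x) * φ x ^ 2 + 2 * h (ρ x) * a x ^ 2 *
            (φ x * inner ℝ (Z x) (grad φ x)) + φ x ^ 2 * deriv h (ρ x)) := by
        simp only [testIntegrand]
        rw [e1, inner_grad_exp_mul_sq hu hφs, e3, real_inner_comm (Z x) (grad u x)]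
        -- The `⟨Z, ∇u⟩` term from differentiating `V^c₁` cancels the drift term, and `a b = 1`
        -- turns `a V^τ b²` into `W`.
        linear_combination (C / ρ x * φ x ^ 2 * h (ρ x)) * e2 +
          (φ x ^ 2 * deriv h (ρ x) * b x ^ 2 - c₁ * inner ℝ (Z x) (grad u x) * φ x ^ 2 *
            h (ρ x)) * e4 + (W * φ x ^ 2 * deriv h (ρ x) * (a x * b x + 1)) * hab x
      rw [e5]
      refine mul_le_mul_of_nonneg_left ?_ hWpos.le
      have h3 := mul_le_mul_of_nonneg_left hcs
        (by have := hh0 _ hr; positivity : 0 ≤ 2 * h (ρ x) * a x ^ 2)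
      have h4 := mul_le_mul_of_nonneg_left hder (sq_nonneg (φ x))
      have e6 : 2 * h (ρ x) * a x ^ 2 * -(b x * ‖grad (n := n) φ x‖ * |φ x|) =
          - (2 * h (ρ x) * |φ x| * (a x * ‖grad (n := n) φ x‖)) := by
        linear_combination (-(2 * h (ρ x) * a x * ‖grad (n := n) φ x‖ * |φ x|)) * hab x
      rw [e6] at h3
      have e7 : 2 * k = C - (2 * m + 1) := by
        rw [hk]
        ring
      rw [e7]
      linarith
    · rw [testIntegrand_of_notMem_tsupport fun hx' => hx (hζsub hx'), hφ0 x hx, hg0 x hx]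
      simp
  rw [integral_sub (iI.const_mul _) iJ, integral_const_mul, integral_const_mul] at hle
  -- The tested integral is multiplied by `k`, never divided by it, so `k = 0` needs no separate
  -- case.
  have := mul_nonpos_of_nonneg_of_nonpos hk0 hneg
  linarith
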